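/- Fix $T>0$ and an integer $m\ge 2$, and let $H=L^2(0,1)$, let $A=\partial_\xi^2$ with domain $D(A)=H^2(0,1)\cap H^1_0(0,1)$ be the Dirichlet Laplacian, with eigenfunctions $-Ae_k=\lambda_ke_k$, $e_k(\xi)=\sqrt2\sin((k+1)\pi\xi)$, $\lambda_k=((k+1)\pi)^2$, $k\ge 0$, and write $H^{-2}:=D(A)^*$. Let $f,g:(0,1)\times[0,T]\times\mathbb R\to\mathbb R$ be Borel functions such that $f(\xi,\cdot,\cdot)$ and $g(\xi,\cdot,\cdot)$ are continuous for every $\xi\in(0,1)$, and assume that there are constants $m_1>0$, $K$, $L$, $L'$ and nonnegative $c_1\in L^2(0,T)$, $c_2\in L^1(0,T)$ such that for all $\xi\in(0,1)$, $t\in[0,T]$, $z,z_1,z_2\in\mathbb R$: (f1) $|f(\xi,t,z)|\le c_1(t)(1+|z|^m)$; (f2) $(f(\xi,t,z_1+z_2)-f(\xi,t,z_1))z_2\le c_2(t)(|z_2|^2+|z_1|^{m_1}+1)$; (g1) $g(\xi,t,z)=g_1(\xi,t,z)+g_2(t,z)$ with Borel functions $g_1,g_2$ satisfying $|g_1(\xi,t,z)|\le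 K(1+|z|)$ and $|g_2(t,z)|\le K(1+|z|^2)$; (g2) $|g(\xi,t,z_1)-g(\xi,t,z_2)|\le L(1+|z_1|+|z_2|)|z_1-z_2|$; (one-sided local Lipschitz condition) $(f(\xi,t,z_1)-f(\xi,t,z_2))(z_1-z_2)\le L'(1+|z_1|^{m-1}+|z_2|^{m-1})|z_1-z_2|^2$. Let $G\in L(H)$ be symmetric and nonnegative with $G^{-1}\in L(H)$, and assume that there are $\theta\ge0$, $q>0$ with $\frac1{2q}+2\theta<1$ and an orthonormal basis $(b_k)$ of $H$ such that $\big\|\big(\sum_k((-A)^{-\theta}\sqrt G\,b_k)^2\big)^{1/2}\big\|_{L^q(0,1)}<\infty$. Let $x\in H$. Let $(\Omega,\mathcal F,(\mathcal F_t)_{t\in[0,T]},P)$ be any filtered probability space with a cylindrical $(\mathcal F_t)$-Wiener process $W$ on $H$, and let $W_A(t)=\int_0^te^{(t-r)A}\sqrt G\,dW(r)$ be the (continuous) stochastic convolution. A solution on this basis of $$dX(t)=\big(\partial_\xi^2X(t)+f(t,X(t))+\partial_\xi g(t,X(t))\big)dt+\sqrt G\,dW(t),\quad X(t,0)=X(t,1)=0,\quad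 X(0)=x,$$ is an $(\mathcal F_t)$-adapted process $X:[0,T]\times\Omega\to H$ such that $P$-a.s. $X\in L^\infty([0,T];L^2(0,1))\cap C([0,T];H^{-2})$ and such that for all $\phi\in C^2([0,1])$ with $\phi(0)=\phi(1)=0$, $P$-a.s., for all $t\in[0,T]$, $$\langle X(t),\phi\rangle=\langle x,\phi\rangle+\int_0^t\langle X(r),\partial_\xi^2\phi\rangle dr+\int_0^t\langle f(r,X(r)),\phi\rangle dr-\int_0^t\langle g(r,X(r)),\partial_\xi\phi\rangle dr+\int_0^t\langle\phi,\sqrt G\,dW(r)\rangle,$$ where the pairings and time integrals are required to exist. **Theorem.** On any such basis there is at most one solution $X$ with $$\int_0^T|X(t)|_{L^{2m}}^{2m}dt<\infty\ \ P\text{-a.s.}\qquad\text{and}\qquad X-W_A\in L^2([0,T];H^1_0(0,1))\ \ P\text{-a.s.}:$$ if $X_1,X_2$ are two such solutions, with the same $W$ and the same $x$, then $P$-a.s. $X_1(t)=X_2(t)$ for all $t\in[0,T]$. -/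

import Mathlib

open MeasureTheory ProbabilityTheory Filter Topology Set
open scoped ENNReal

noncomputable section

namespace SPDE

/-- Lebesgue measure on the open unit interval. -/
abbrev μ01 : Measure ℝ := volume.restrict (Ioo (0 : ℝ) 1)

/-- The state space `H = L²(0,1)`. -/
abbrev H : Type := Lp ℝ 2 μ01

theorem memLp_of_continuous {φ : ℝ → ℝ} (hφ : Continuous φ) : MemLp φ 2 μ01 := by
  obtain ⟨C, hC⟩ := isCompact_Icc.exists_bound_of_continuousOn
    (s := Icc (0 : ℝ) 1) hφ.continuousOn
  refine MemLp.of_bound hφ.aestronglyMeasurable C ?_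
  filter_upwards [ae_restrict_mem measurableSet_Ioo] with x hx
  exact hC x (Ioo_subset_Icc_self hx)

/-- The class in `H` of a continuous function. -/
def toH (φ : ℝ → ℝ) (hφ : Continuous φ) : H := (memLp_of_continuous hφ).toLp φ

/-! ### The Dirichlet Laplacian `A = ∂²/∂ξ²`, `D(A) = H² ∩ H₀¹`

It is diagonal in the orthonormal basis `e_k(ξ) = √2 sin((k+1)πξ)`, `k ≥ 0`, with
`A e_k = -λ_k e_k`, `λ_k = ((k+1)π)²`. -/

/-- The eigenvalue `λ_k` of `-A`. -/
def eigval (k : ℕ) : ℝ := (((k : ℝ) + 1) * Real.pi) ^ 2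

/-- The normalized eigenfunction `e_k` of `-A`. -/
def eigfun (k : ℕ) : H :=
  toH (fun ξ => √2 * Real.sin (((k : ℝ) + 1) * Real.pi * ξ)) (by fun_prop)

/-- `ψ(-A) h = ∑ₖ ψ(λ_k) ⟨e_k, h⟩ e_k`; used below only for bounded `ψ`. -/
def spectralFun (ψ : ℝ → ℝ) (h : H) : H :=
  ∑' k, (ψ (eigval k) * inner ℝ (eigfun k) h) • eigfun k

/-- The semigroup `e^{tA}`, `t ≥ 0`. -/
def heatSemigroup (t : ℝ) : H → H := spectralFun fun l => Real.exp (-(t * l))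

/-- The negative fractional power `(-A)^{-θ}`, `θ ≥ 0`. -/
def negFracPow (θ : ℝ) : H → H := spectralFun fun l => l ^ (-θ)

/-- The norm of `H⁻² = D(A)*` on elements of `H`. -/
def hMinusTwoNorm (x : H) : ℝ :=
  √(∑' k, ((eigval k)⁻¹ * inner ℝ (eigfun k) x) ^ 2)

/-- `Y ∈ C([0,T]; H⁻²)`, for an `H`-valued path `Y`. -/
def ContinuousHMinusTwo (T : ℝ) (Y : ℝ → H) : Prop :=
  ∀ t ∈ Icc 0 T, Tendsto (fun s => hMinusTwoNorm (Y s - Y t)) (𝓝[Icc 0 T] t) (𝓝 0)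

/-! ### The Sobolev space `H₀¹(0,1)` -/

/-- `u ∈ H₀¹(0,1)` with weak derivative `v`: `(u, v)` is a limit in `L² × L²` of pairs `(φ, φ')`
with `φ` smooth and compactly supported in `(0,1)`. Thus `H₀¹(0,1)` is identified with the closed
subspace of such pairs, the norm being the graph norm. -/
def HasH01Deriv (u v : H) : Prop :=
  (u, v) ∈ closure {p : H × H | ∃ φ : ℝ → ℝ, ContDiff ℝ (⊤ : ℕ∞) φ ∧ HasCompactSupport φ ∧
    tsupport φ ⊆ Ioo 0 1 ∧ p.1 =ᵐ[μ01] φ ∧ p.2 =ᵐ[μ01] deriv φ}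

/-- `Y ∈ L²([0,T]; H₀¹(0,1))`. -/
def MemL2H01 (T : ℝ) (Y : ℝ → H) : Prop :=
  MemLp Y 2 (volume.restrict (Icc 0 T)) ∧
    ∃ Z : ℝ → H, MemLp Z 2 (volume.restrict (Icc 0 T)) ∧
      ∀ᵐ t ∂(volume.restrict (Icc 0 T)), HasH01Deriv (Y t) (Z t)

/-! ### Conditions on the coefficients `f(ξ,t,z)`, `g(ξ,t,z)`

Only the values on `(0,1) × [0,T] × ℝ` matter; the functions are extended to `ℝ³` in a Borel
measurable way. -/

/-- Borel measurable, and continuous in `(t,z)` for each `ξ`. -/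
def IsCoefficient (T : ℝ) (f : ℝ → ℝ → ℝ → ℝ) : Prop :=
  Measurable (fun p : ℝ × ℝ × ℝ => f p.1 p.2.1 p.2.2) ∧
    ∀ ξ ∈ Ioo (0 : ℝ) 1, ContinuousOn (fun p : ℝ × ℝ => f ξ p.1 p.2) (Icc 0 T ×ˢ univ)

/-- `|f(ξ,t,z)| ≤ c₁(t)(1+|z|^m)` with `0 ≤ c₁ ∈ L²(0,T)`. -/
def PolynomialGrowth (T : ℝ) (m : ℕ) (f : ℝ → ℝ → ℝ → ℝ) : Prop :=
  ∃ c₁ : ℝ → ℝ, MemLp c₁ 2 (volume.restrict (Icc 0 T)) ∧ (∀ t ∈ Icc 0 T, 0 ≤ c₁ t) ∧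
    ∀ t ∈ Icc 0 T, ∀ z : ℝ, ∀ ξ ∈ Ioo (0 : ℝ) 1, |f ξ t z| ≤ c₁ t * (1 + |z| ^ m)

/-- `(f(ξ,t,z₁+z₂) - f(ξ,t,z₁)) z₂ ≤ c₂(t)(|z₂|² + |z₁|^{m₁} + 1)` with `0 ≤ c₂ ∈ L¹(0,T)`. -/
def Dissipativity (T : ℝ) (f : ℝ → ℝ → ℝ → ℝ) : Prop :=
  ∃ (c₂ : ℝ → ℝ) (m₁ : ℝ), 0 < m₁ ∧ IntegrableOn c₂ (Icc 0 T) ∧ (∀ t ∈ Icc 0 T, 0 ≤ c₂ t) ∧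
    ∀ t ∈ Icc 0 T, ∀ z₁ z₂ : ℝ, ∀ ξ ∈ Ioo (0 : ℝ) 1,
      (f ξ t (z₁ + z₂) - f ξ t z₁) * z₂ ≤ c₂ t * (|z₂| ^ 2 + |z₁| ^ m₁ + 1)

/-- `g = g₁ + g₂` with `g₁` of linear growth and `g₂ = g₂(t,z)` of quadratic growth. -/
def BurgersGrowth (T : ℝ) (g : ℝ → ℝ → ℝ → ℝ) : Prop :=
  ∃ (g₁ : ℝ → ℝ → ℝ → ℝ) (g₂ : ℝ → ℝ → ℝ) (K : ℝ),
    Measurable (fun p : ℝ × ℝ × ℝ => g₁ p.1 p.2.1 p.2.2) ∧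
    Measurable (fun p : ℝ × ℝ => g₂ p.1 p.2) ∧
    ∀ t ∈ Icc 0 T, ∀ ξ ∈ Ioo (0 : ℝ) 1, ∀ z : ℝ,
      g ξ t z = g₁ ξ t z + g₂ t z ∧ |g₁ ξ t z| ≤ K * (1 + |z|) ∧ |g₂ t z| ≤ K * (1 + |z| ^ 2)

/-- Local Lipschitz condition on `g` with linearly growing Lipschitz constant. -/
def BurgersLipschitz (T : ℝ) (g : ℝ → ℝ → ℝ → ℝ) : Prop :=
  ∃ L : ℝ, ∀ t ∈ Icc 0 T, ∀ ξ ∈ Ioo (0 : ℝ) 1, ∀ z₁ z₂ : ℝ,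
    |g ξ t z₁ - g ξ t z₂| ≤ L * (1 + |z₁| + |z₂|) * |z₁ - z₂|

/-- One-sided local Lipschitz condition on `f`. -/
def OneSidedLocalLipschitz (T : ℝ) (m : ℕ) (f : ℝ → ℝ → ℝ → ℝ) : Prop :=
  ∃ L : ℝ, ∀ t ∈ Icc 0 T, ∀ ξ ∈ Ioo (0 : ℝ) 1, ∀ z₁ z₂ : ℝ,
    (f ξ t z₁ - f ξ t z₂) * (z₁ - z₂) ≤
      L * (1 + |z₁| ^ (m - 1) + |z₂| ^ (m - 1)) * |z₁ - z₂| ^ 2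

/-! ### The noise -/

/-- The nonnegative square root `√G` of a symmetric nonnegative bounded operator `G`: the unique
symmetric nonnegative `Q` with `Q² = G`. -/
def opSqrt (G : H →L[ℝ] H) : H →L[ℝ] H :=
  Classical.epsilon fun Q => Q.IsPositive ∧ Q ∘L Q = G

/-- `‖(∑ₖ ((-A)^{-θ} √G b_k)²)^{1/2}‖_{L^q} < ∞` for an orthonormal basis `b` of `H` and some
`θ ≥ 0`, `q > 0` with `1/(2q) + 2θ < 1`. -/
def NoiseRegularity (G : H →L[ℝ] H) : Prop :=
  ∃ (b : HilbertBasis ℕ ℝ H) (θ q : ℝ), 0 ≤ θ ∧ 0 < q ∧ 1 / (2 * q) + 2 * θ < 1 ∧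
    ∫⁻ ξ, (∑' k, ‖negFracPow θ (opSqrt G (b k)) ξ‖ₑ ^ 2) ^ (q / 2) ∂μ01 < ∞

variable {Ω : Type*} {mΩ : MeasurableSpace Ω}

/-- `W` is a cylindrical Wiener process on `H` over `[0,T]` with respect to the filtration `ℱ`;
`W t h` is the real random variable usually written `⟨W(t), h⟩`. -/
structure IsCylindricalWiener (T : ℝ) (P : Measure Ω) (ℱ : Filtration (Icc (0 : ℝ) T) mΩ)
    (W : ℝ → H → Ω → ℝ) : Prop where
  adapted : ∀ (t : Icc (0 : ℝ) T) (h : H), Measurable[ℱ t] (W t h)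
  linear : ∀ t ∈ Icc 0 T, ∀ (a b : ℝ) (h k : H),
    ∀ᵐ ω ∂P, W t (a • h + b • k) ω = a * W t h ω + b * W t k ω
  initial : ∀ h : H, ∀ᵐ ω ∂P, W 0 h ω = 0
  continuous_paths : ∀ h : H, ∀ᵐ ω ∂P, ContinuousOn (fun t => W t h ω) (Icc 0 T)
  law_increment : ∀ s t : Icc (0 : ℝ) T, s ≤ t → ∀ h : H,
    P.map (fun ω => W t h ω - W s h ω) =
      gaussianReal 0 (Real.toNNReal (((t : ℝ) - s) * ‖h‖ ^ 2))
  indep_increment : ∀ s t : Icc (0 : ℝ) T, s ≤ t → ∀ h : H,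
    Indep (MeasurableSpace.comap (fun ω => W t h ω - W s h ω) (borel ℝ)) (ℱ s) P

/-- `I` is (a version of) the Wiener integral `∫₀ᵗ ⟨Φ(r), dW(r)⟩` of a deterministic continuous
`Φ : [0,t] → H`: the `L²(P)`-limit of the integrals of the step functions with the values
`Φ(i t / n)` on `(i t / n, (i+1) t / n]`. -/
def IsWienerIntegral (P : Measure Ω) (W : ℝ → H → Ω → ℝ) (t : ℝ) (Φ : ℝ → H) (I : Ω → ℝ) : Prop :=
  AEStronglyMeasurable I P ∧
    Tendsto (fun n : ℕ => eLpNorm (fun ω =>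
      (∑ i ∈ Finset.range n,
        (W (((i : ℝ) + 1) * t / n) (Φ ((i : ℝ) * t / n)) ω
          - W ((i : ℝ) * t / n) (Φ ((i : ℝ) * t / n)) ω)) - I ω) 2 P) atTop (𝓝 0)

/-- `WA` is (a version with continuous paths of) the stochastic convolution
`W_A(t) = ∫₀ᵗ e^{(t-r)A} √G dW(r)`, i.e. `⟨W_A(t), h⟩ = ∫₀ᵗ ⟨√G e^{(t-r)A} h, dW(r)⟩` for
all `h ∈ H`. -/
structure IsStochasticConvolution (T : ℝ) (P : Measure Ω) (W : ℝ → H → Ω → ℝ) (G : H →L[ℝ] H)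
    (WA : ℝ → Ω → H) : Prop where
  aestronglyMeasurable : ∀ t ∈ Icc 0 T, AEStronglyMeasurable (WA t) P
  continuous_paths : ∀ᵐ ω ∂P, ContinuousOn (fun t => WA t ω) (Icc 0 T)
  integral : ∀ t ∈ Icc 0 T, ∀ h : H,
    IsWienerIntegral P W t (fun r => opSqrt G (heatSemigroup (t - r) h))
      (fun ω => inner ℝ (WA t ω) h)

/-- `X` is a solution on the given stochastic basis, driven by the given `W`, of
`dX = (∂²X/∂ξ² + f(t,X) + ∂g(t,X)/∂ξ) dt + √G dW`, `X(t,0) = X(t,1) = 0`, `X(0) = x`.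
The test functions are the `φ ∈ C²([0,1])` with `φ(0) = φ(1) = 0` (each is the restriction of a
`C²` function on `ℝ`). The integrand of `∫₀ᵗ ⟨φ, √G dW(r)⟩ = ⟨W(t), √G φ⟩` is constant in time. -/
structure IsSolution (T : ℝ) (f g : ℝ → ℝ → ℝ → ℝ) (G : H →L[ℝ] H) (x : H) (P : Measure Ω)
    (ℱ : Filtration (Icc (0 : ℝ) T) mΩ) (W : ℝ → H → Ω → ℝ) (X : ℝ → Ω → H) : Prop where
  adapted : ∀ t : Icc (0 : ℝ) T, StronglyMeasurable[ℱ t] (X t)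
  bounded : ∀ᵐ ω ∂P, MemLp (fun t => X t ω) ∞ (volume.restrict (Icc 0 T))
  continuous : ∀ᵐ ω ∂P, ContinuousHMinusTwo T (fun t => X t ω)
  /-- the pairings `⟨f(r,X(r)), φ⟩` and `⟨g(r,X(r)), ∂φ⟩` are meaningful -/
  integrable_space : ∀ᵐ ω ∂P, ∀ᵐ r ∂(volume.restrict (Icc 0 T)),
    Integrable (fun ξ => f ξ r (X r ω ξ)) μ01 ∧ Integrable (fun ξ => g ξ r (X r ω ξ)) μ01
  /-- the time integrals of these pairings are meaningful -/
  integrable_time : ∀ φ : ℝ → ℝ, ContDiff ℝ 2 φ → φ 0 = 0 → φ 1 = 0 → ∀ᵐ ω ∂P,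
    IntegrableOn (fun r => ∫ ξ, f ξ r (X r ω ξ) * φ ξ ∂μ01) (Icc 0 T) ∧
    IntegrableOn (fun r => ∫ ξ, g ξ r (X r ω ξ) * deriv φ ξ ∂μ01) (Icc 0 T)
  equation : ∀ (φ : ℝ → ℝ) (hφ : ContDiff ℝ 2 φ), φ 0 = 0 → φ 1 = 0 →
    ∀ᵐ ω ∂P, ∀ t ∈ Icc 0 T,
      ∫ ξ, X t ω ξ * φ ξ ∂μ01 =
        (∫ ξ, x ξ * φ ξ ∂μ01)
        + (∫ r in 0..t, ∫ ξ, X r ω ξ * deriv (deriv φ) ξ ∂μ01)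
        + (∫ r in 0..t, ∫ ξ, f ξ r (X r ω ξ) * φ ξ ∂μ01)
        - (∫ r in 0..t, ∫ ξ, g ξ r (X r ω ξ) * deriv φ ξ ∂μ01)
        + W t (opSqrt G (toH φ hφ.continuous)) ω

/-- `∫₀ᵀ |X(t)|_{L^{2m}}^{2m} dt < ∞` almost surely. -/
def FiniteL2mNorm (T : ℝ) (m : ℕ) (P : Measure Ω) (X : ℝ → Ω → H) : Prop :=
  ∀ᵐ ω ∂P, ∫⁻ t in Icc 0 T, (eLpNorm (X t ω) ((2 * m : ℕ) : ℝ≥0∞) μ01) ^ (2 * m) < ∞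

/-- `X - W_A ∈ L²([0,T]; H₀¹(0,1))` almost surely, where `W_A` is the stochastic convolution
(which is unique up to indistinguishability). -/
def RegularModuloConvolution (T : ℝ) (P : Measure Ω) (W : ℝ → H → Ω → ℝ) (G : H →L[ℝ] H)
    (X : ℝ → Ω → H) : Prop :=
  ∃ WA : ℝ → Ω → H, IsStochasticConvolution T P W G WA ∧
    ∀ᵐ ω ∂P, MemL2H01 T (fun t => X t ω - WA t ω)

end SPDE

end

open SPDE

/-!
Pathwise, the difference `u = X₁ - X₂` of two solutions solves the deterministic equation
`∂ₜu = ∂²u + F + ∂Γ`, `u(0) = 0`, with `F = f(X₁) - f(X₂)` and `Γ = g(X₁) - g(X₂)`: the noise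
cancels. The stochastic convolution is unique up to indistinguishability
(`IsStochasticConvolution.ae_eq`), so `u` lies in `L²([0,T]; H₀¹)`, and uniqueness is an energy
estimate.

At a fixed time put `A = (1 + |X₁| + |X₂|)^m`. The one-sided Lipschitz condition on `f` and the
Lipschitz condition on `g` give `F u ≤ C A u²` and `Γ² ≤ C A u²`, the latter because `m ≥ 2`
(`nemytskii_sub_bounds`). Combined with the Agmon inequality `|u|²_∞ ≤ 2 |u| |∂u|`
(`HasH01Deriv.sq_le`) and Young's inequality they yield
`-|∂u|² + ⟨F, u⟩ - ⟨Γ, ∂u⟩ ≤ C' (1 + |A|²) |u|²` (`HasH01Deriv.energy_le`), where `|A|²` is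
integrable in time since both solutions lie in `L^{2m}([0,T] × (0,1))`.

The energy identity `|u(t)|² = 2 ∫₀ᵗ (-|∂u|² + ⟨F, u⟩ - ⟨Γ, ∂u⟩)` is first obtained for the
truncated sums `∑_{k<n} ⟨u, e_k⟩²`, whose terms are absolutely continuous in time, and then passes
to the limit by dominated convergence: `|⟨F, u⟩|` and `|⟨Γ, ∂u⟩|` have integrable majorants
because `F ∈ L¹([0,T]; L²)`, `u ∈ L^∞([0,T]; L²)` and `Γ, ∂u ∈ L²([0,T]; L²)`. The
limit uses that the sines and the cosines are both Hilbert bases of `L²(0,1)`, differentiation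
taking the one expansion to the other. Gronwall's lemma with an integrable coefficient
(`nonpos_of_le_integral_mul`) then gives `u(t) = 0` for every `t` (`eq_zero_of_energy_le`).
-/

open MeasureTheory ProbabilityTheory Filter Topology Set
open scoped ENNReal

noncomputable section

namespace SPDE

/-! ### The sine and cosine bases of `L²(0,1)` -/

theorem inner_eq_integral (u v : H) : inner ℝ u v = ∫ ξ, u ξ * v ξ ∂μ01 := by
  rw [L2.inner_def]
  refine integral_congr_ae (ae_of_all _ fun ξ => ?_)
  simp [mul_comm]

theorem coeFn_toH (φ : ℝ → ℝ) (hφ : Continuous φ) : toH φ hφ =ᵐ[μ01] φ :=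
  (memLp_of_continuous hφ).coeFn_toLp

theorem inner_toH (φ : ℝ → ℝ) (hφ : Continuous φ) (u : H) :
    inner ℝ (toH φ hφ) u = ∫ ξ, u ξ * φ ξ ∂μ01 := by
  rw [inner_eq_integral]
  refine integral_congr_ae ?_
  filter_upwards [coeFn_toH φ hφ] with ξ hξ
  rw [hξ, mul_comm]

theorem integral_μ01 (φ : ℝ → ℝ) : ∫ ξ, φ ξ ∂μ01 = ∫ ξ in (0 : ℝ)..1, φ ξ := by
  rw [intervalIntegral.integral_of_le zero_le_one, integral_Ioc_eq_integral_Ioo]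

theorem inner_toH_toH (φ ψ : ℝ → ℝ) (hφ : Continuous φ) (hψ : Continuous ψ) :
    inner ℝ (toH φ hφ) (toH ψ hψ) = ∫ ξ in (0 : ℝ)..1, φ ξ * ψ ξ := by
  rw [inner_toH, ← integral_μ01]
  refine integral_congr_ae ?_
  filter_upwards [coeFn_toH ψ hψ] with ξ hξ
  rw [hξ, mul_comm]

/-- The `k`-th element of the orthonormal cosine basis of `L²(0,1)`: the constant `1` for `k = 0`
and `√2 cos(kπξ)` for `k ≥ 1`. -/
def cosMode (k : ℕ) : H :=
  toH (fun ξ => (if k = 0 then 1 else √2) * Real.cos ((k : ℝ) * Real.pi * ξ)) (by fun_prop)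

theorem integral_cos_int_mul_pi {a : ℝ} {n : ℤ} (hn : n ≠ 0) (ha : a = n * Real.pi) :
    ∫ ξ in (0 : ℝ)..1, Real.cos (a * ξ) = 0 := by
  have h0 : a ≠ 0 := by
    rw [ha]; exact mul_ne_zero (by exact_mod_cast hn) Real.pi_ne_zero
  rw [intervalIntegral.integral_comp_mul_left _ h0]
  simp [ha, Real.sin_int_mul_pi]

theorem integral_cos_mul_cos (a b : ℝ) : ∫ ξ in (0 : ℝ)..1, Real.cos (a * ξ) * Real.cos (b * ξ) =
    ((∫ ξ in (0 : ℝ)..1, Real.cos ((a - b) * ξ)) + ∫ ξ in (0 : ℝ)..1, Real.cos ((a + b) * ξ)) / 2 := by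
  rw [← intervalIntegral.integral_add (Continuous.intervalIntegrable (by fun_prop) _ _)
    (Continuous.intervalIntegrable (by fun_prop) _ _), ← intervalIntegral.integral_div]
  congr 1; ext ξ
  rw [sub_mul, add_mul, Real.cos_sub, Real.cos_add]; ring

theorem integral_sin_mul_sin (a b : ℝ) : ∫ ξ in (0 : ℝ)..1, Real.sin (a * ξ) * Real.sin (b * ξ) =
    ((∫ ξ in (0 : ℝ)..1, Real.cos ((a - b) * ξ)) - ∫ ξ in (0 : ℝ)..1, Real.cos ((a + b) * ξ)) / 2 := by
  rw [← intervalIntegral.integral_sub (Continuous.intervalIntegrable (by fun_prop) _ _)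
    (Continuous.intervalIntegrable (by fun_prop) _ _), ← intervalIntegral.integral_div]
  congr 1; ext ξ
  rw [sub_mul, add_mul, Real.cos_sub, Real.cos_add]; ring

theorem orthonormal_eigfun : Orthonormal ℝ eigfun := by
  rw [orthonormal_iff_ite]
  intro j k
  have h2 : (√2 : ℝ) * √2 = 2 := Real.mul_self_sqrt (by norm_num)
  have hadd : ∫ ξ in (0 : ℝ)..1, Real.cos ((((j : ℝ) + 1) * Real.pi + ((k : ℝ) + 1) * Real.pi) * ξ)
      = 0 :=
    integral_cos_int_mul_pi (n := (j : ℤ) + 1 + (k + 1)) (by omega) (by push_cast; ring)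
  have : inner ℝ (eigfun j) (eigfun k) =
      ∫ ξ in (0 : ℝ)..1, Real.cos ((((j : ℝ) + 1) * Real.pi - ((k : ℝ) + 1) * Real.pi) * ξ) := by
    rw [eigfun, eigfun, inner_toH_toH]
    simp only [mul_mul_mul_comm _ _ (√2 : ℝ), h2, intervalIntegral.integral_const_mul,
      integral_sin_mul_sin, hadd]
    ring
  rw [this]
  split_ifs with h
  · subst h; simp
  · exact integral_cos_int_mul_pi (n := (j : ℤ) - k) (by omega) (by push_cast; ring)

theorem orthonormal_cosMode : Orthonormal ℝ cosMode := by
  rw [orthonormal_iff_ite]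
  intro j k
  have h2 : (√2 : ℝ) * √2 = 2 := Real.mul_self_sqrt (by norm_num)
  have key : inner ℝ (cosMode j) (cosMode k) = ((if j = 0 then 1 else √2) *
      (if k = 0 then 1 else √2)) *
      (((∫ ξ in (0 : ℝ)..1, Real.cos (((j : ℝ) * Real.pi - (k : ℝ) * Real.pi) * ξ)) +
      ∫ ξ in (0 : ℝ)..1, Real.cos (((j : ℝ) * Real.pi + (k : ℝ) * Real.pi) * ξ)) / 2) := by
    rw [cosMode, cosMode, inner_toH_toH, ← integral_cos_mul_cos,
      ← intervalIntegral.integral_const_mul]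
    congr 1; ext ξ; ring
  rw [key]
  rcases eq_or_ne j k with rfl | h
  · rcases eq_or_ne j 0 with rfl | h0
    · simp
    · rw [integral_cos_int_mul_pi (a := (j : ℝ) * Real.pi + j * Real.pi) (n := (j : ℤ) + j) (by omega) (by push_cast; ring)]
      simp [h0, h2]
  · rw [integral_cos_int_mul_pi (a := (j : ℝ) * Real.pi + k * Real.pi) (n := (j : ℤ) + k) (by omega) (by push_cast; ring),
      integral_cos_int_mul_pi (a := (j : ℝ) * Real.pi - k * Real.pi) (n := (j : ℤ) - k) (by omega)
        (by push_cast; ring)]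
    simp [h]

theorem integrable_coeFn (u : H) : Integrable u μ01 :=
  (Lp.memLp u).integrable (by norm_num)

theorem integrable_mul_continuous (u : H) {φ : ℝ → ℝ} (hφ : Continuous φ) :
    Integrable (fun ξ => u ξ * φ ξ) μ01 :=
  (Lp.memLp u).integrable_mul (memLp_of_continuous hφ)

/-- By the addition formula, the functions whose product with `w` is orthogonal to all cosines are
stable under multiplication by `cos(πξ)`, hence include all polynomials in `cos(πξ)`; these are
dense in `C([0,1])` by the Stone–Weierstrass theorem. -/
theorem eq_zero_of_integral_mul_cos {w : ℝ → ℝ} (hw : Integrable w μ01)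
    (h : ∀ k : ℕ, ∫ ξ, w ξ * Real.cos (k * Real.pi * ξ) ∂μ01 = 0) : w =ᵐ[μ01] 0 := by
  have hint : ∀ {φ : ℝ → ℝ}, Continuous φ → Integrable (fun ξ => w ξ * φ ξ) μ01 := by
    intro φ hφ
    obtain ⟨C, hC⟩ := isCompact_Icc.exists_bound_of_continuousOn
      (s := Icc (0 : ℝ) 1) hφ.continuousOn
    refine hw.mul_bdd (c := C) hφ.aestronglyMeasurable ?_
    filter_upwards [ae_restrict_mem measurableSet_Ioo] with x hx
    exact hC x (Ioo_subset_Icc_self hx)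
  have hpow : ∀ n k : ℕ, ∫ ξ, w ξ * (Real.cos (Real.pi * ξ) ^ n * Real.cos (k * Real.pi * ξ)) ∂μ01
      = 0 := by
    intro n
    induction n with
    | zero => simpa using h
    | succ n ih =>
      intro k
      rcases k with _ | k
      · have := ih 1
        simpa [pow_succ] using this
      · have e : ∀ ξ, w ξ * (Real.cos (Real.pi * ξ) ^ (n + 1) *
            Real.cos ((k + 1 : ℕ) * Real.pi * ξ)) =
            (w ξ * (Real.cos (Real.pi * ξ) ^ n * Real.cos ((k + 2 : ℕ) * Real.pi * ξ)) +
             w ξ * (Real.cos (Real.pi * ξ) ^ n * Real.cos (k * Real.pi * ξ))) / 2 := by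
          intro ξ
          have e1 : ((k + 2 : ℕ) : ℝ) * Real.pi * ξ =
            (k + 1 : ℕ) * Real.pi * ξ + Real.pi * ξ := by push_cast; ring
          have e2 : (k : ℝ) * Real.pi * ξ =
            (k + 1 : ℕ) * Real.pi * ξ - Real.pi * ξ := by push_cast; ring
          rw [e1, e2, Real.cos_add, Real.cos_sub]; ring
        simp_rw [e]
        rw [integral_div, integral_add (hint (by fun_prop)) (hint (by fun_prop)), ih, ih]
        simp
  let cs : C(Icc (0 : ℝ) 1, ℝ) := ⟨fun x => Real.cos (Real.pi * x), by fun_prop⟩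
  let A : Subalgebra ℝ C(Icc (0 : ℝ) 1, ℝ) := Algebra.adjoin ℝ {cs}
  have hsep : A.SeparatesPoints := by
    intro x y hxy
    refine ⟨cs, ⟨cs, Algebra.self_mem_adjoin_singleton ℝ cs, rfl⟩, fun hc => hxy ?_⟩
    have := Real.injOn_cos (x₁ := Real.pi * x) (x₂ := Real.pi * y)
      ⟨by have := x.2.1; positivity, by nlinarith [x.2.2, Real.pi_pos]⟩
      ⟨by have := y.2.1; positivity, by nlinarith [y.2.2, Real.pi_pos]⟩ hc
    exact Subtype.ext (mul_left_cancel₀ Real.pi_ne_zero this)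
  have hzero : ∀ φ : ℝ → ℝ, Continuous φ → ∫ ξ, w ξ * φ ξ ∂μ01 = 0 := by
    intro φ hφ
    have hbound : ∀ ε > 0, |∫ ξ, w ξ * φ ξ ∂μ01| ≤ ε * ∫ ξ, |w ξ| ∂μ01 := by
      intro ε hε
      obtain ⟨⟨p, hp⟩, hpε⟩ := ContinuousMap.exists_mem_subalgebra_near_continuous_of_separatesPoints
        A hsep (fun x => φ x) (by fun_prop) ε hε
      obtain ⟨q, rfl⟩ : ∃ q, Polynomial.aeval cs q = p := by
        have hp' : p ∈ Algebra.adjoin ℝ {cs} := hp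
        rwa [Algebra.adjoin_singleton_eq_range_aeval] at hp'
      have hq : ∫ ξ, w ξ * q.eval (Real.cos (Real.pi * ξ)) ∂μ01 = 0 := by
        simp_rw [Polynomial.eval_eq_sum_range, Finset.mul_sum]
        rw [integral_finsetSum _ fun i _ => hint (by fun_prop)]
        refine Finset.sum_eq_zero fun i _ => ?_
        have := hpow i 0
        simp only [Nat.cast_zero, zero_mul, Real.cos_zero, mul_one] at this
        simp_rw [mul_left_comm (w _), integral_const_mul, this, mul_zero]
      have hev : ∀ ξ : Icc (0 : ℝ) 1, (Polynomial.aeval cs q) ξ =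
          q.eval (Real.cos (Real.pi * ξ)) := by
        intro ξ
        have := Polynomial.aeval_algHom_apply (ContinuousMap.evalAlgHom ℝ ℝ ξ) cs q
        rw [ContinuousMap.evalAlgHom_apply, ContinuousMap.evalAlgHom_apply] at this
        rw [← this]
        rfl
      rw [← sub_zero (∫ ξ, w ξ * φ ξ ∂μ01), ← hq, ← integral_sub (hint hφ) (hint (by fun_prop)),
        ← integral_const_mul]
      refine (abs_integral_le_integral_abs).trans (integral_mono_ae ?_ (hw.abs.const_mul ε) ?_)
      · exact ((hint hφ).sub (hint (by fun_prop))).abs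
      · filter_upwards [ae_restrict_mem measurableSet_Ioo] with ξ hξ
        have := hpε ⟨ξ, Ioo_subset_Icc_self hξ⟩
        rw [hev, Real.norm_eq_abs, abs_sub_comm] at this
        rw [← mul_sub, abs_mul, mul_comm]
        exact mul_le_mul_of_nonneg_right this.le (abs_nonneg _)
    refine abs_eq_zero.1 (le_antisymm ?_ (abs_nonneg _))
    have ht : Tendsto (fun ε : ℝ => ε * ∫ ξ, |w ξ| ∂μ01) (𝓝[>] 0) (𝓝 0) := by
      have : Tendsto (fun ε : ℝ => ε * ∫ ξ, |w ξ| ∂μ01) (𝓝 0) (𝓝 (0 * ∫ ξ, |w ξ| ∂μ01)) :=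
        (continuous_id.mul continuous_const).tendsto 0
      rw [zero_mul] at this
      exact this.mono_left nhdsWithin_le_nhds
    exact ge_of_tendsto ht (eventually_nhdsWithin_of_forall hbound)
  refine ae_eq_zero_of_integral_contDiff_smul_eq_zero hw.locallyIntegrable fun φ hφ _ => ?_
  simpa [mul_comm] using hzero φ hφ.continuous

theorem eq_zero_of_inner_cosMode {u : H} (h : ∀ k, inner ℝ (cosMode k) u = 0) : u = 0 := by
  refine (Lp.eq_zero_iff_ae_eq_zero).2 (eq_zero_of_integral_mul_cos (integrable_coeFn u) fun k => ?_)
  have := h k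
  rw [cosMode, inner_toH] at this
  simp_rw [mul_left_comm (u _), integral_const_mul] at this
  refine (mul_eq_zero.1 this).resolve_left ?_
  split_ifs <;> simp

/-- `sin(πξ) cos(kπξ)` is a combination of sines, so a function orthogonal to all sines vanishes
after multiplication by `sin(πξ)`, which is positive on `(0,1)`. -/
theorem eq_zero_of_inner_eigfun {u : H} (h : ∀ k, inner ℝ (eigfun k) u = 0) : u = 0 := by
  have hs : ∀ k : ℕ, ∫ ξ, u ξ * Real.sin ((k : ℝ) * Real.pi * ξ) ∂μ01 = 0 := by
    intro k
    rcases k with _ | k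
    · simp
    · have := h k
      rw [eigfun, inner_toH] at this
      simp_rw [mul_left_comm (u _), integral_const_mul] at this
      push_cast
      exact (mul_eq_zero.1 this).resolve_left (by simp)
  have hw : (fun ξ => u ξ * Real.sin (Real.pi * ξ)) =ᵐ[μ01] 0 := by
    refine eq_zero_of_integral_mul_cos (integrable_mul_continuous u (by fun_prop)) fun k => ?_
    rcases k with _ | k
    · simpa using hs 1
    · have e : ∀ ξ, u ξ * Real.sin (Real.pi * ξ) * Real.cos ((k + 1 : ℕ) * Real.pi * ξ) =
          (u ξ * Real.sin ((k + 2 : ℕ) * Real.pi * ξ) - u ξ * Real.sin (k * Real.pi * ξ)) / 2 := by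
        intro ξ
        have e1 : ((k + 2 : ℕ) : ℝ) * Real.pi * ξ =
          (k + 1 : ℕ) * Real.pi * ξ + Real.pi * ξ := by push_cast; ring
        have e2 : (k : ℝ) * Real.pi * ξ =
          (k + 1 : ℕ) * Real.pi * ξ - Real.pi * ξ := by push_cast; ring
        rw [e1, e2, Real.sin_add, Real.sin_sub]; ring
      simp_rw [e]
      rw [integral_div, integral_sub (integrable_mul_continuous u (by fun_prop))
        (integrable_mul_continuous u (by fun_prop)), hs, hs]
      simp
  refine (Lp.eq_zero_iff_ae_eq_zero).2 ?_
  filter_upwards [hw, ae_restrict_mem measurableSet_Ioo] with ξ hξ hmem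
  have hpos : 0 < Real.sin (Real.pi * ξ) := by
    refine Real.sin_pos_of_pos_of_lt_pi (mul_pos Real.pi_pos hmem.1) ?_
    nlinarith [hmem.2, Real.pi_pos]
  exact (mul_eq_zero.1 hξ).resolve_right hpos.ne'

theorem orthogonal_span_range_eq_bot {v : ℕ → H} (hv : ∀ u : H, (∀ k, inner ℝ (v k) u = 0) → u = 0) :
    (Submodule.span ℝ (range v))ᗮ = ⊥ := by
  refine (Submodule.eq_bot_iff _).2 fun u hu => hv u fun k => ?_
  exact (Submodule.mem_orthogonal _ u).1 hu _ (Submodule.subset_span (mem_range_self k))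

/-- The eigenfunctions of the Dirichlet Laplacian, as a Hilbert basis of `L²(0,1)`. -/
def sinBasis : HilbertBasis ℕ ℝ H :=
  HilbertBasis.mkOfOrthogonalEqBot orthonormal_eigfun
    (orthogonal_span_range_eq_bot fun _ => eq_zero_of_inner_eigfun)

/-- The cosines, as a Hilbert basis of `L²(0,1)`. -/
def cosBasis : HilbertBasis ℕ ℝ H :=
  HilbertBasis.mkOfOrthogonalEqBot orthonormal_cosMode
    (orthogonal_span_range_eq_bot fun _ => eq_zero_of_inner_cosMode)

theorem sinBasis_apply (k : ℕ) : sinBasis k = eigfun k := by simp [sinBasis]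

theorem cosBasis_apply (k : ℕ) : cosBasis k = cosMode k := by simp [cosBasis]

/-! ### The space `H₀¹(0,1)` and the energy estimate at a fixed time -/

theorem HasH01Deriv.sub {u v u' v' : H} (h : HasH01Deriv u v) (h' : HasH01Deriv u' v') :
    HasH01Deriv (u - u') (v - v') := by
  refine map_mem_closure₂ (f := fun p q : H × H => p - q) (by fun_prop) h h' ?_
  rintro p ⟨φ, hφ, hc, hs, h1, h2⟩ q ⟨ψ, hψ, hc', hs', h1', h2'⟩
  refine ⟨φ - ψ, hφ.sub hψ, hc.sub hc', (tsupport_sub φ ψ).trans (union_subset hs hs'), ?_, ?_⟩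
  · filter_upwards [Lp.coeFn_sub p.1 q.1, h1, h1'] with ξ e e1 e2
    simp only [Prod.fst_sub, e, Pi.sub_apply, e1, e2]
  · filter_upwards [Lp.coeFn_sub p.2 q.2, h2, h2'] with ξ e e1 e2
    have := deriv_sub (hφ.differentiable (by simp) ξ) (hψ.differentiable (by simp) ξ)
    simp only [Prod.snd_sub, e, Pi.sub_apply, e1, e2, this]

/-- Integration by parts against a continuously differentiable function, without boundary terms. -/
theorem HasH01Deriv.integral_mul {u v : H} (h : HasH01Deriv u v) {ψ ψ' : ℝ → ℝ}
    (hψ : ∀ ξ, HasDerivAt ψ (ψ' ξ) ξ) (hc : Continuous ψ) (hc' : Continuous ψ') :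
    inner ℝ (toH ψ hc) v = -inner ℝ (toH ψ' hc') u := by
  refine closure_minimal (t := {p : H × H | inner ℝ (toH ψ hc) p.2 = -inner ℝ (toH ψ' hc') p.1})
    ?_ (isClosed_eq (by fun_prop) (by fun_prop)) h
  rintro ⟨p, q⟩ ⟨φ, hφ, -, hs, h1, h2⟩
  have hz : ∀ ξ, ξ ∉ Ioo (0 : ℝ) 1 → φ ξ = 0 := fun ξ hξ =>
    image_eq_zero_of_notMem_tsupport fun hm => hξ (hs hm)
  have hd : Continuous (deriv φ) := hφ.continuous_deriv (by simp)
  have e1 : ∫ ξ, q ξ * ψ ξ ∂μ01 = ∫ ξ in (0 : ℝ)..1, ψ ξ * deriv φ ξ := by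
    rw [← integral_μ01]
    refine integral_congr_ae ?_
    filter_upwards [h2] with ξ e
    rw [e, mul_comm]
  have e2 : ∫ ξ, p ξ * ψ' ξ ∂μ01 = ∫ ξ in (0 : ℝ)..1, ψ' ξ * φ ξ := by
    rw [← integral_μ01]
    refine integral_congr_ae ?_
    filter_upwards [h1] with ξ e
    rw [e, mul_comm]
  simp only [mem_ofPred_eq, inner_toH, e1, e2]
  rw [intervalIntegral.integral_mul_deriv_eq_deriv_mul (fun ξ _ => hψ ξ)
    (fun ξ _ => (hφ.differentiable (by simp) ξ).hasDerivAt) (hc'.intervalIntegrable _ _)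
    (hd.intervalIntegrable _ _), hz 0 (by simp), hz 1 (by simp)]
  simp

theorem HasH01Deriv.inner_cosMode_zero {u v : H} (h : HasH01Deriv u v) :
    inner ℝ (cosMode 0) v = 0 := by
  have := h.integral_mul (ψ := fun ξ => (if (0 : ℕ) = 0 then 1 else √2) *
    Real.cos ((0 : ℕ) * Real.pi * ξ)) (ψ' := fun _ => 0)
    (fun ξ => by simpa using hasDerivAt_const ξ (1 : ℝ)) (by fun_prop) (by fun_prop)
  rw [cosMode, this, inner_toH]
  simp

theorem HasH01Deriv.inner_cosMode_succ {u v : H} (h : HasH01Deriv u v) (k : ℕ) :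
    inner ℝ (cosMode (k + 1)) v = ((k : ℝ) + 1) * Real.pi * inner ℝ (eigfun k) u := by
  have := h.integral_mul (ψ := fun ξ => (if k + 1 = 0 then 1 else √2) *
    Real.cos ((k + 1 : ℕ) * Real.pi * ξ))
    (ψ' := fun ξ => -((((k : ℝ) + 1) * Real.pi) * (√2 * Real.sin (((k : ℝ) + 1) * Real.pi * ξ))))
    (fun ξ => by
      have h1 := ((hasDerivAt_id ξ).const_mul (((k : ℝ) + 1) * Real.pi)).cos.const_mul √2
      simp only [Nat.succ_ne_zero, if_false, Nat.cast_add, Nat.cast_one]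
      exact h1.congr_deriv (by simp only [id_eq, mul_one]; ring)) (by fun_prop) (by fun_prop)
  rw [cosMode, this, eigfun, inner_toH, inner_toH]
  simp_rw [mul_neg, integral_neg, neg_neg, mul_left_comm _ (((k : ℝ) + 1) * Real.pi),
    integral_const_mul]

/-- The one-dimensional Agmon inequality `|u|²_∞ ≤ 2 |u| |∂u|`. -/
theorem HasH01Deriv.sq_le {u v : H} (h : HasH01Deriv u v) :
    ∀ᵐ ξ ∂μ01, (u ξ) ^ 2 ≤ 2 * ‖u‖ * ‖v‖ := by
  obtain ⟨p, hp, hlim⟩ := mem_closure_iff_seq_limit.1 h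
  have hle : ∀ n, ∀ᵐ ξ ∂μ01, ((p n).1 ξ) ^ 2 ≤ 2 * ‖(p n).1‖ * ‖(p n).2‖ := by
    intro n
    obtain ⟨φ, hφ, -, hs, h1, h2⟩ := hp n
    have hd : Continuous (deriv φ) := hφ.continuous_deriv (by simp)
    have hcs : ∫ ξ, |φ ξ| * |deriv φ ξ| ∂μ01 ≤ ‖(p n).1‖ * ‖(p n).2‖ := by
      have := real_inner_le_norm |(p n).1| |(p n).2|
      rw [norm_abs_eq_norm, norm_abs_eq_norm, inner_eq_integral] at this
      refine le_trans (le_of_eq (integral_congr_ae ?_)) this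
      filter_upwards [h1, h2, Lp.coeFn_abs (p n).1, Lp.coeFn_abs (p n).2] with ξ e1 e2 e3 e4
      rw [e3, e4, e1, e2]
    filter_upwards [h1, ae_restrict_mem measurableSet_Ioo] with ξ e hξ
    have h0 : φ 0 = 0 := image_eq_zero_of_notMem_tsupport fun hm => by simpa using hs hm
    have hint : ∫ x in (0 : ℝ)..ξ, 2 * (φ x * deriv φ x) = φ ξ ^ 2 := by
      have := intervalIntegral.integral_eq_sub_of_hasDerivAt (a := 0) (b := ξ)
        (f := fun x => φ x ^ 2) (f' := fun x => 2 * (φ x * deriv φ x)) (fun x _ => by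
          exact ((hφ.differentiable (by simp) x).hasDerivAt.fun_pow 2).congr_deriv
            (by push_cast; ring)) ((by have := hφ.continuous; fun_prop : Continuous _).intervalIntegrable _ _)
      simpa [h0] using this
    rw [e, ← hint, intervalIntegral.integral_const_mul, mul_assoc]
    refine mul_le_mul_of_nonneg_left (le_trans ?_ hcs) (by norm_num)
    rw [intervalIntegral.integral_of_le hξ.1.le]
    refine (le_abs_self _).trans (abs_integral_le_integral_abs.trans ?_)
    simp_rw [abs_mul]
    refine setIntegral_mono_set ?_ (ae_of_all _ fun x => by positivity) ?_
    · have : Integrable (fun x => |φ x| * |deriv φ x|) (volume.restrict (Icc (0 : ℝ) 1)) :=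
        (by have := hφ.continuous; fun_prop : Continuous _).integrableOn_Icc
      exact this.mono_measure (Measure.restrict_mono Ioo_subset_Icc_self le_rfl)
    · exact (show Ioc 0 ξ ⊆ Ioo (0 : ℝ) 1 from fun x hx => ⟨hx.1, hx.2.trans_lt hξ.2⟩).eventuallyLE
  have h1 : Tendsto (fun n => (p n).1) atTop (𝓝 u) := (continuous_fst.tendsto _).comp hlim
  have h2 : Tendsto (fun n => (p n).2) atTop (𝓝 v) := (continuous_snd.tendsto _).comp hlim
  obtain ⟨ns, hns, hae⟩ := (tendstoInMeasure_of_tendsto_Lp h1).exists_seq_tendsto_ae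
  filter_upwards [hae, ae_all_iff.2 hle] with ξ hξ hb
  exact le_of_tendsto_of_tendsto' (hξ.pow 2)
    (((h1.norm.const_mul 2).mul h2.norm).comp hns.tendsto_atTop) fun n => hb (ns n)

/-- The absorption argument for the difference `u` of two solutions at a fixed time: the growth of
the coefficients is measured by the single function `A`, and the Agmon and Young inequalities
trade it against the dissipation `|∂u|²`. -/
theorem HasH01Deriv.energy_le {u v F Γ A : H} (h : HasH01Deriv u v) {C : ℝ} (hC : 0 ≤ C)
    (hA : ∀ᵐ ξ ∂μ01, 0 ≤ A ξ) (hF : ∀ᵐ ξ ∂μ01, F ξ * u ξ ≤ C * (A ξ * u ξ ^ 2))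
    (hΓ : ∀ᵐ ξ ∂μ01, Γ ξ ^ 2 ≤ C * (A ξ * u ξ ^ 2)) :
    -‖v‖ ^ 2 + inner ℝ F u - inner ℝ Γ v ≤ (2 * C ^ 2 + 1) * (1 + ‖A‖ ^ 2) * ‖u‖ ^ 2 := by
  set S := √(2 * ‖u‖ * ‖v‖) with hS
  have hS2 : S ^ 2 = 2 * ‖u‖ * ‖v‖ := Real.sq_sqrt (by positivity)
  have hu : ∀ᵐ ξ ∂μ01, |u ξ| ≤ S := by
    filter_upwards [h.sq_le] with ξ hξ using Real.abs_le_sqrt hξ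
  have hint : Integrable (fun ξ => A ξ * |u ξ|) μ01 :=
    (Lp.memLp A).integrable_mul (Lp.memLp u).abs
  have hle : ∀ᵐ ξ ∂μ01, A ξ * u ξ ^ 2 ≤ S * (A ξ * |u ξ|) := by
    filter_upwards [hA, hu] with ξ h1 h2
    rw [← sq_abs, sq, ← mul_assoc, mul_comm S]
    exact mul_le_mul_of_nonneg_left h2 (by positivity)
  have hintJ : Integrable (fun ξ => A ξ * u ξ ^ 2) μ01 := by
    refine (hint.const_mul S).mono'
      ((Lp.aestronglyMeasurable A).mul ((Lp.aestronglyMeasurable u).pow 2)) ?_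
    filter_upwards [hA, hle] with ξ h1 h2
    rwa [Real.norm_of_nonneg (by positivity)]
  set J := ∫ ξ, A ξ * u ξ ^ 2 ∂μ01 with hJ
  have hJle : J ≤ S * (‖A‖ * ‖u‖) := by
    have := real_inner_le_norm A |u|
    rw [norm_abs_eq_norm, inner_eq_integral] at this
    have h1 : ∫ ξ, A ξ * |u ξ| ∂μ01 ≤ ‖A‖ * ‖u‖ := by
      refine le_trans (le_of_eq (integral_congr_ae ?_)) this
      filter_upwards [Lp.coeFn_abs u] with ξ e
      rw [e]
    refine (integral_mono_ae hintJ (hint.const_mul S) hle).trans ?_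
    rw [integral_const_mul]
    exact mul_le_mul_of_nonneg_left h1 (Real.sqrt_nonneg _)
  have hFu : inner ℝ F u ≤ C * J := by
    rw [inner_eq_integral, hJ, ← integral_const_mul]
    exact integral_mono_ae ((Lp.memLp F).integrable_mul (Lp.memLp u)) (hintJ.const_mul C) hF
  have hΓΓ : ‖Γ‖ ^ 2 ≤ C * J := by
    rw [← real_inner_self_eq_norm_sq, inner_eq_integral, hJ, ← integral_const_mul]
    refine integral_mono_ae ((Lp.memLp Γ).integrable_mul (Lp.memLp Γ)) (hintJ.const_mul C) ?_
    filter_upwards [hΓ] with ξ e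
    simpa [sq] using e
  have hΓv : -inner ℝ Γ v ≤ ‖Γ‖ * ‖v‖ := (neg_le_abs _).trans (abs_real_inner_le_norm _ _)
  have hCJ : C * J ≤ C * (S * (‖A‖ * ‖u‖)) := mul_le_mul_of_nonneg_left hJle hC
  -- With `C J ≤ C S |A| |u|`, Young's inequality `3/2 C S |A| |u| ≤ S² / 2 + 9/8 C² |A|² |u|²` and
  -- `S² = 2 |u| |v| ≤ |u|² + |v|²` leave a multiple of `|v|²` that the dissipation absorbs.
  nlinarith [sq_nonneg (‖Γ‖ - ‖v‖), sq_nonneg (‖u‖ - ‖v‖), sq_nonneg (S - 3 / 2 * C * (‖A‖ * ‖u‖)),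
    mul_nonneg (sq_nonneg C) (sq_nonneg (‖A‖ * ‖u‖)), sq_nonneg (C * ‖u‖), sq_nonneg (‖A‖ * ‖u‖),
    sq_nonneg ‖u‖]

/-! ### Gronwall's lemma and the energy method -/

/-- The chain rule for powers of an indefinite Lebesgue integral. -/
theorem integral_pow_succ_eq {h : ℝ → ℝ} {t : ℝ} (hh : IntervalIntegrable h volume 0 t) (n : ℕ) :
    (∫ s in (0 : ℝ)..t, h s) ^ (n + 1) =
      (n + 1) * ∫ r in (0 : ℝ)..t, (∫ s in (0 : ℝ)..r, h s) ^ n * h r := by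
  have hac : AbsolutelyContinuousOnInterval (fun r => ∫ s in (0 : ℝ)..r, h s) 0 t :=
    hh.absolutelyContinuousOnInterval_intervalIntegral (c := 0) (by simp)
  have hpow : ∀ k : ℕ, AbsolutelyContinuousOnInterval
      (fun r => (∫ s in (0 : ℝ)..r, h s) ^ (k + 1)) 0 t := by
    intro k
    induction k with
    | zero => simpa using hac
    | succ k ih => simpa [pow_succ] using ih.fun_mul hac
  have := (hpow n).integral_deriv_eq_sub
  simp only [intervalIntegral.integral_same, ne_eq, Nat.succ_ne_zero, not_false_eq_true, zero_pow,
    sub_zero] at this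
  rw [← this, ← intervalIntegral.integral_const_mul]
  refine intervalIntegral.integral_congr_ae ?_
  filter_upwards [hh.ae_hasDerivAt_integral] with r hr hmem
  have := (hr (uIoc_subset_uIcc hmem) 0 (by simp)).pow (n + 1)
  have h2 := this.deriv
  simp only [add_tsub_cancel_right] at h2
  push_cast at h2
  rw [← mul_assoc]
  exact h2

theorem intervalIntegrable_of_integrableOn_Icc {h : ℝ → ℝ} {T t : ℝ} (hh : IntegrableOn h (Icc 0 T))
    (ht : t ∈ Icc 0 T) : IntervalIntegrable h volume 0 t := by
  rw [intervalIntegrable_iff_integrableOn_Icc_of_le ht.1]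
  exact hh.mono_set (Icc_subset_Icc_right ht.2)

theorem ae_Icc_of_le {p : ℝ → Prop} {T t : ℝ} (hp : ∀ᵐ r ∂volume.restrict (Icc 0 T), p r)
    (ht : t ≤ T) : ∀ᵐ r ∂volume.restrict (Icc 0 t), p r :=
  ae_restrict_of_ae_restrict_of_subset (Icc_subset_Icc_right ht) hp

/-- Gronwall's lemma with an integrable coefficient and zero initial value, for a function that is
merely bounded and measurable: iterating the inequality gives `w ≤ M Bⁿ / n!` with
`B t = ∫₀ᵗ β`. -/
theorem nonpos_of_le_integral_mul {T M : ℝ} {β w : ℝ → ℝ} (hβ : IntegrableOn β (Icc 0 T))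
    (hβ0 : ∀ᵐ r ∂volume.restrict (Icc 0 T), 0 ≤ β r)
    (hw : AEStronglyMeasurable w (volume.restrict (Icc 0 T)))
    (hwM : ∀ᵐ r ∂volume.restrict (Icc 0 T), |w r| ≤ M)
    (hle : ∀ t ∈ Icc 0 T, w t ≤ ∫ r in (0 : ℝ)..t, β r * w r) :
    ∀ t ∈ Icc 0 T, w t ≤ 0 := by
  have hβw : IntegrableOn (fun r => β r * w r) (Icc 0 T) := Integrable.mul_bdd hβ hw hwM
  set B : ℝ → ℝ := fun t => ∫ s in (0 : ℝ)..t, β s with hB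
  have hstep : ∀ n : ℕ, (∀ᵐ r ∂volume.restrict (Icc 0 T), w r ≤ M * B r ^ n / n.factorial) →
      ∀ t ∈ Icc 0 T, w t ≤ M * B t ^ (n + 1) / (n + 1).factorial := by
    intro n hn t ht
    have hβt := intervalIntegrable_of_integrableOn_Icc hβ ht
    have hBc : ContinuousOn B (uIcc 0 t) :=
      (hβt.absolutelyContinuousOnInterval_intervalIntegral (c := 0) (by simp)).continuousOn
    have hpow : B t ^ (n + 1) = (n + 1) * ∫ r in (0 : ℝ)..t, B r ^ n * β r :=
      integral_pow_succ_eq hβt n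
    refine (hle t ht).trans ?_
    have : ∫ r in (0 : ℝ)..t, β r * w r ≤
        ∫ r in (0 : ℝ)..t, M / n.factorial * (B r ^ n * β r) := by
      refine intervalIntegral.integral_mono_ae_restrict ht.1
        (intervalIntegrable_of_integrableOn_Icc hβw ht)
        ((hβt.continuousOn_mul (hBc.pow n)).const_mul _) ?_
      filter_upwards [ae_Icc_of_le hn ht.2, ae_Icc_of_le hβ0 ht.2] with r h1 h2
      calc β r * w r ≤ β r * (M * B r ^ n / n.factorial) := mul_le_mul_of_nonneg_left h1 h2
        _ = _ := by ring
    refine this.trans (le_of_eq ?_)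
    rw [intervalIntegral.integral_const_mul, hpow, Nat.factorial_succ]
    push_cast
    have : (n.factorial : ℝ) ≠ 0 := by exact_mod_cast n.factorial_ne_zero
    field_simp
  have hall : ∀ n : ℕ, ∀ t ∈ Icc 0 T, w t ≤ M * B t ^ (n + 1) / (n + 1).factorial := by
    intro n
    induction n with
    | zero =>
      refine hstep 0 ?_
      filter_upwards [hwM] with r hr
      simpa using (le_abs_self _).trans hr
    | succ n ih =>
      refine hstep (n + 1) ?_
      filter_upwards [ae_restrict_mem measurableSet_Icc] with r hr using ih r hr
  intro t ht
  have hlim : Tendsto (fun n : ℕ => M * (B t ^ (n + 1) / (n + 1).factorial)) atTop (𝓝 (M * 0)) :=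
    (((FloorSemiring.tendsto_pow_div_factorial_atTop (B t)).comp (tendsto_add_atTop_nat 1))).const_mul M
  rw [mul_zero] at hlim
  exact ge_of_tendsto' hlim fun n => by simpa [mul_div_assoc] using hall n t ht

/-- Bessel's inequality in bilinear form. -/
theorem abs_sum_inner_mul_inner_le {b : ℕ → H} (hb : Orthonormal ℝ b) (x y : H) (N : ℕ) :
    |∑ k ∈ Finset.range N, inner ℝ x (b k) * inner ℝ (b k) y| ≤ ‖x‖ * ‖y‖ := by
  have hx : ∑ k ∈ Finset.range N, inner ℝ x (b k) ^ 2 ≤ ‖x‖ ^ 2 := by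
    have := hb.sum_inner_products_le x (s := Finset.range N)
    simpa [real_inner_comm] using this
  have hy : ∑ k ∈ Finset.range N, inner ℝ (b k) y ^ 2 ≤ ‖y‖ ^ 2 := by
    have := hb.sum_inner_products_le y (s := Finset.range N)
    simpa using this
  refine abs_le_of_sq_le_sq ?_ (by positivity)
  rw [mul_pow]
  exact (Finset.sum_mul_sq_le_sq_mul_sq _ _ _).trans (by gcongr)

theorem tendsto_sum_inner_eigfun (x y : H) :
    Tendsto (fun N => ∑ k ∈ Finset.range N, inner ℝ x (eigfun k) * inner ℝ (eigfun k) y) atTop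
      (𝓝 (inner ℝ x y)) := by
  have := (sinBasis.hasSum_inner_mul_inner x y).tendsto_sum_nat
  simpa only [sinBasis_apply] using this

/-- Parseval's identity in the cosine basis, when the mean of one factor vanishes. -/
theorem tendsto_sum_inner_cosMode (x : H) {y : H} (hy : inner ℝ (cosMode 0) y = 0) :
    Tendsto (fun N => ∑ k ∈ Finset.range N,
      inner ℝ x (cosMode (k + 1)) * inner ℝ (cosMode (k + 1)) y) atTop (𝓝 (inner ℝ x y)) := by
  have := (cosBasis.hasSum_inner_mul_inner x y).tendsto_sum_nat.comp (tendsto_add_atTop_nat 1)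
  refine this.congr fun N => ?_
  simp [cosBasis_apply, Finset.sum_range_succ', hy]

/-- Uniqueness for the linear problem `∂ₜu = ∂²u + F + ∂Γ`, `u(0) = 0`, in Fourier coefficients,
when the energy production of `F` and `Γ` is controlled by `β |u|²`. The energy identity
`|u(t)|² = 2 ∫₀ᵗ (-|∂u|² + ⟨F, u⟩ - ⟨Γ, ∂u⟩)` is the limit of its Galerkin truncations, and
Gronwall's lemma applies to it. The paths `F` and `Γ` need not be measurable, only their
coefficients. -/
theorem eq_zero_of_energy_le {T : ℝ} {u v F Γ : ℝ → H} {β D : ℝ → ℝ}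
    (hu : MemLp u ∞ (volume.restrict (Icc 0 T))) (hv : MemLp v 2 (volume.restrict (Icc 0 T)))
    (huv : ∀ᵐ r ∂volume.restrict (Icc 0 T), HasH01Deriv (u r) (v r))
    (hF : ∀ k, IntegrableOn (fun r => inner ℝ (F r) (eigfun k)) (Icc 0 T))
    (hΓ : ∀ k, IntegrableOn (fun r => inner ℝ (Γ r) (cosMode (k + 1))) (Icc 0 T))
    (hD : IntegrableOn D (Icc 0 T))
    (hFD : ∀ᵐ r ∂volume.restrict (Icc 0 T), ‖F r‖ ≤ D r)
    (hΓD : ∀ᵐ r ∂volume.restrict (Icc 0 T), ‖Γ r‖ ^ 2 ≤ D r)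
    (hβ : IntegrableOn β (Icc 0 T)) (hβ0 : ∀ᵐ r ∂volume.restrict (Icc 0 T), 0 ≤ β r)
    (hen : ∀ᵐ r ∂volume.restrict (Icc 0 T),
      -‖v r‖ ^ 2 + inner ℝ (F r) (u r) - inner ℝ (Γ r) (v r) ≤ β r * ‖u r‖ ^ 2)
    (heq : ∀ k, ∀ t ∈ Icc 0 T, inner ℝ (eigfun k) (u t) =
      ∫ r in (0 : ℝ)..t, (-(eigval k * inner ℝ (eigfun k) (u r)) + inner ℝ (F r) (eigfun k)
        - ((k : ℝ) + 1) * Real.pi * inner ℝ (Γ r) (cosMode (k + 1)))) :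
    ∀ t ∈ Icc 0 T, u t = 0 := by
  set ν := volume.restrict (Icc (0 : ℝ) T) with hν
  set M := (eLpNorm u ∞ ν).toReal with hM
  have huM : ∀ᵐ r ∂ν, ‖u r‖ ≤ M := by
    have hfin : eLpNormEssSup u ν ≠ ∞ := by simpa using hu.2.ne
    filter_upwards [ae_le_eLpNormEssSup (f := u) (μ := ν)] with r hr
    rw [hM, eLpNorm_exponent_top]
    simpa using ENNReal.toReal_mono hfin hr
  have hui : ∀ k, IntegrableOn (fun r => inner ℝ (eigfun k) (u r)) (Icc 0 T) := fun k =>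
    (hu.integrable le_top).const_inner _
  set h : ℕ → ℝ → ℝ := fun k r => -(eigval k * inner ℝ (eigfun k) (u r)) +
    inner ℝ (F r) (eigfun k) - ((k : ℝ) + 1) * Real.pi * inner ℝ (Γ r) (cosMode (k + 1)) with hh
  have hhi : ∀ k, IntegrableOn (h k) (Icc 0 T) := fun k =>
    (((hui k).const_mul _).neg.add (hF k)).sub ((hΓ k).const_mul _)
  have hpi : ∀ k, IntegrableOn (fun r => inner ℝ (eigfun k) (u r) * h k r) (Icc 0 T) := by
    intro k
    refine Integrable.bdd_mul (c := M) (hhi k) (hui k).1 ?_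
    filter_upwards [huM] with r hr
    refine (norm_inner_le_norm _ _).trans ?_
    rwa [orthonormal_eigfun.1 k, one_mul]
  have hsq : ∀ k, ∀ t ∈ Icc 0 T, inner ℝ (eigfun k) (u t) ^ 2 =
      2 * ∫ r in (0 : ℝ)..t, inner ℝ (eigfun k) (u r) * h k r := by
    intro k t ht
    have := integral_pow_succ_eq (intervalIntegrable_of_integrableOn_Icc (hhi k) ht) 1
    rw [heq k t ht, this]
    norm_num
    refine intervalIntegral.integral_congr fun r hr => ?_
    rw [uIcc_of_le ht.1] at hr
    rw [heq k r ⟨hr.1, hr.2.trans ht.2⟩]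
  set g : ℕ → ℝ → ℝ := fun N r => ∑ k ∈ Finset.range N, inner ℝ (eigfun k) (u r) * h k r with hg
  have hgi : ∀ N, IntegrableOn (g N) (Icc 0 T) := fun N =>
    integrable_finsetSum _ fun k _ => hpi k
  -- `E` is half the time derivative of `|u|²`, and `g N` that of its `N`-th Galerkin truncation
  set E : ℝ → ℝ := fun r => -‖v r‖ ^ 2 + inner ℝ (F r) (u r) - inner ℝ (Γ r) (v r) with hE
  -- the derivative turns sine coefficients into cosine coefficients
  have hg_eq : ∀ᵐ r ∂ν, ∀ N, g N r =
      -(∑ k ∈ Finset.range N, inner ℝ (v r) (cosMode (k + 1)) * inner ℝ (cosMode (k + 1)) (v r)) +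
      (∑ k ∈ Finset.range N, inner ℝ (F r) (eigfun k) * inner ℝ (eigfun k) (u r)) -
      ∑ k ∈ Finset.range N, inner ℝ (Γ r) (cosMode (k + 1)) * inner ℝ (cosMode (k + 1)) (v r) := by
    filter_upwards [huv] with r hr N
    rw [hg, ← Finset.sum_neg_distrib, ← Finset.sum_add_distrib, ← Finset.sum_sub_distrib]
    refine Finset.sum_congr rfl fun k _ => ?_
    rw [real_inner_comm (cosMode (k + 1)) (v r), hr.inner_cosMode_succ k, hh]
    simp only [eigval]
    ring
  have hg_lim : ∀ᵐ r ∂ν, Tendsto (fun N => g N r) atTop (𝓝 (E r)) := by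
    filter_upwards [huv, hg_eq] with r hr he
    simp_rw [he, hE, ← real_inner_self_eq_norm_sq]
    exact ((tendsto_sum_inner_cosMode _ hr.inner_cosMode_zero).neg.add
      (tendsto_sum_inner_eigfun _ _)).sub (tendsto_sum_inner_cosMode _ hr.inner_cosMode_zero)
  have hcos := orthonormal_cosMode.comp (fun k : ℕ => k + 1) (add_left_injective 1)
  have hM0 : 0 ≤ M := ENNReal.toReal_nonneg
  have hg_bound : ∀ᵐ r ∂ν, ∀ N, ‖g N r‖ ≤ 2 * ‖v r‖ ^ 2 + (M + 1) * D r := by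
    filter_upwards [hg_eq, huM, hFD, hΓD] with r he h1 h2 h3 N
    have b1 := abs_le.1 (abs_sum_inner_mul_inner_le hcos (v r) (v r) N)
    have b2 := abs_le.1 (abs_sum_inner_mul_inner_le orthonormal_eigfun (F r) (u r) N)
    have b3 := abs_le.1 (abs_sum_inner_mul_inner_le hcos (Γ r) (v r) N)
    simp only [Function.comp_apply] at b1 b3
    have b4 : ‖F r‖ * ‖u r‖ ≤ D r * M := by gcongr; exact (norm_nonneg _).trans h2
    rw [he N, Real.norm_eq_abs, abs_le]
    constructor <;> nlinarith [sq_nonneg (‖Γ r‖ - ‖v r‖), sq_nonneg ‖v r‖]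
  have hdom : IntegrableOn (fun r => 2 * ‖v r‖ ^ 2 + (M + 1) * D r) (Icc 0 T) :=
    ((hv.integrable_norm_pow two_ne_zero).const_mul 2).add (hD.const_mul _)
  have hEi : IntegrableOn E (Icc 0 T) := by
    refine hdom.mono' (aestronglyMeasurable_of_tendsto_ae _ (fun N => (hgi N).1) hg_lim) ?_
    filter_upwards [hg_lim, hg_bound] with r h1 h2
    exact le_of_tendsto' h1.norm h2
  have henergy : ∀ t ∈ Icc 0 T, ‖u t‖ ^ 2 = 2 * ∫ r in (0 : ℝ)..t, E r := by
    intro t ht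
    have hsub : Ioc 0 t ⊆ Icc 0 T := fun r hr => ⟨hr.1.le, hr.2.trans ht.2⟩
    have hlim : Tendsto (fun N => ∫ r in (0 : ℝ)..t, g N r) atTop
        (𝓝 (∫ r in (0 : ℝ)..t, E r)) := by
      simp_rw [intervalIntegral.integral_of_le ht.1]
      refine tendsto_integral_of_dominated_convergence _ (fun N => ((hgi N).mono_set hsub).1)
        (hdom.mono_set hsub) (fun N => ?_) (ae_restrict_of_ae_restrict_of_subset hsub hg_lim)
      filter_upwards [ae_restrict_of_ae_restrict_of_subset hsub hg_bound] with r hr using hr N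
    have hlim2 := tendsto_sum_inner_eigfun (u t) (u t)
    rw [real_inner_self_eq_norm_sq] at hlim2
    refine tendsto_nhds_unique (hlim2.congr fun N => ?_) (hlim.const_mul 2)
    rw [hg, intervalIntegral.integral_finsetSum fun k _ =>
      intervalIntegrable_of_integrableOn_Icc (hpi k) ht, Finset.mul_sum]
    refine Finset.sum_congr rfl fun k _ => ?_
    rw [← hsq k t ht, real_inner_comm, sq]
  have hwm : AEStronglyMeasurable (fun r => ‖u r‖ ^ 2) ν := hu.1.norm.pow 2
  have hwM : ∀ᵐ r ∂ν, |‖u r‖ ^ 2| ≤ M ^ 2 := by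
    filter_upwards [huM] with r hr
    rw [abs_of_nonneg (by positivity)]
    gcongr
  have hgron := nonpos_of_le_integral_mul (w := fun r => ‖u r‖ ^ 2) (hβ.const_mul 2)
    (by filter_upwards [hβ0] with r hr; positivity) hwm hwM fun t ht => by
      rw [henergy t ht, ← intervalIntegral.integral_const_mul]
      refine intervalIntegral.integral_mono_ae_restrict ht.1
        ((intervalIntegrable_of_integrableOn_Icc hEi ht).const_mul 2)
        (intervalIntegrable_of_integrableOn_Icc
          (Integrable.mul_bdd (hβ.const_mul 2) hwm hwM) ht) ?_
      filter_upwards [ae_Icc_of_le hen ht.2] with r hr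
      rw [mul_assoc]
      exact mul_le_mul_of_nonneg_left hr (by norm_num)
  intro t ht
  have := hgron t ht
  exact norm_eq_zero.1 (pow_eq_zero_iff two_ne_zero |>.1 (le_antisymm this (by positivity)))

/-! ### Increments of the coefficients -/

theorem lowerSemicontinuous_eLpNorm_coeFn (p : ℝ≥0∞) :
    LowerSemicontinuous fun u : H => eLpNorm u p μ01 := by
  refine lowerSemicontinuous_iff_isClosed_preimage.2 fun a => IsSeqClosed.isClosed ?_
  intro w u hw hlim
  obtain ⟨ns, -, hae⟩ := (tendstoInMeasure_of_tendsto_Lp hlim).exists_seq_tendsto_ae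
  refine (Lp.eLpNorm_lim_le_liminf_eLpNorm (fun n => Lp.aestronglyMeasurable (w (ns n))) _ hae).trans
    ?_
  exact liminf_le_of_le (by isBoundedDefault) fun b hb => by
    obtain ⟨n, hn⟩ := hb.exists
    exact hn.trans (hw (ns n))

theorem aemeasurable_eLpNorm_comp {X : ℝ → H} {ν : Measure ℝ} (hX : AEStronglyMeasurable X ν)
    (p : ℝ≥0∞) : AEMeasurable (fun t => eLpNorm (X t) p μ01) ν := by
  borelize H
  exact (lowerSemicontinuous_eLpNorm_coeFn p).measurable.comp_aemeasurable hX.aemeasurable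

theorem integral_norm_pow_eq_toReal (u : H) {n : ℕ} (hn : n ≠ 0) :
    ∫ ξ, |u ξ| ^ n ∂μ01 = (eLpNorm u (n : ℝ≥0∞) μ01 ^ n).toReal := by
  have h := eLpNorm_nnreal_pow_eq_lintegral (f := u) (μ := μ01) (p := (n : NNReal))
    (by exact_mod_cast hn)
  simp only [NNReal.coe_natCast, ENNReal.rpow_natCast, ENNReal.coe_natCast] at h
  have hmeas : AEStronglyMeasurable (fun ξ => |u ξ| ^ n) μ01 :=
    (Lp.aestronglyMeasurable u).norm.pow n
  rw [h, integral_eq_lintegral_of_nonneg_ae (ae_of_all _ fun ξ => by positivity) hmeas]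
  congr 1
  refine lintegral_congr fun ξ => ?_
  rw [ENNReal.ofReal_pow (abs_nonneg _), ← Real.norm_eq_abs, ofReal_norm]

/-- The function `(1 + |X| + |Y|)^m`, which controls the growth of the coefficients along two
paths. -/
def growthWeight (m : ℕ) (X Y : H) (ξ : ℝ) : ℝ := (1 + |X ξ| + |Y ξ|) ^ m

theorem one_le_base (x y : ℝ) : 1 ≤ 1 + |x| + |y| := by
  have := abs_nonneg x; have := abs_nonneg y; linarith

theorem growthWeight_sq_le (m : ℕ) (X Y : H) (ξ : ℝ) :
    growthWeight m X Y ξ ^ 2 ≤ 3 ^ (2 * m) * (1 + |X ξ| ^ (2 * m) + |Y ξ| ^ (2 * m)) := by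
  have hx := abs_nonneg (X ξ)
  have hy := abs_nonneg (Y ξ)
  have px := pow_nonneg hx (2 * m)
  have py := pow_nonneg hy (2 * m)
  have key : ∀ z : ℝ, 0 ≤ z → 1 + |X ξ| + |Y ξ| ≤ 3 * z →
      z ^ (2 * m) ≤ 1 + |X ξ| ^ (2 * m) + |Y ξ| ^ (2 * m) →
      growthWeight m X Y ξ ^ 2 ≤ 3 ^ (2 * m) * (1 + |X ξ| ^ (2 * m) + |Y ξ| ^ (2 * m)) := by
    intro z hz h1 h2
    rw [growthWeight, ← pow_mul, mul_comm m 2]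
    calc (1 + |X ξ| + |Y ξ|) ^ (2 * m) ≤ (3 * z) ^ (2 * m) := by gcongr
      _ = 3 ^ (2 * m) * z ^ (2 * m) := mul_pow _ _ _
      _ ≤ _ := by gcongr
  rcases le_total |X ξ| |Y ξ| with h | h
  · rcases le_total 1 |Y ξ| with h' | h'
    · exact key |Y ξ| hy (by linarith) (by linarith)
    · exact key 1 zero_le_one (by linarith) (by rw [one_pow]; linarith)
  · rcases le_total 1 |X ξ| with h' | h'
    · exact key |X ξ| hx (by linarith) (by linarith)
    · exact key 1 zero_le_one (by linarith) (by rw [one_pow]; linarith)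

theorem aestronglyMeasurable_growthWeight (m : ℕ) (X Y : H) :
    AEStronglyMeasurable (growthWeight m X Y) μ01 :=
  (((Lp.aestronglyMeasurable X).norm.const_add 1).add (Lp.aestronglyMeasurable Y).norm).pow m

theorem integrable_pow_of_eLpNorm_lt_top {m : ℕ} {X : H}
    (hX : eLpNorm X ((2 * m : ℕ) : ℝ≥0∞) μ01 < ∞) : Integrable (fun ξ => |X ξ| ^ (2 * m)) μ01 :=
  (show MemLp X ((2 * m : ℕ) : ℝ≥0∞) μ01 from ⟨Lp.aestronglyMeasurable X, hX⟩).integrable_norm_pow'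

theorem memLp_growthWeight {m : ℕ} {X Y : H} (hX : eLpNorm X ((2 * m : ℕ) : ℝ≥0∞) μ01 < ∞)
    (hY : eLpNorm Y ((2 * m : ℕ) : ℝ≥0∞) μ01 < ∞) : MemLp (growthWeight m X Y) 2 μ01 := by
  rw [memLp_two_iff_integrable_sq (aestronglyMeasurable_growthWeight m X Y)]
  refine ((((integrable_const 1).add (integrable_pow_of_eLpNorm_lt_top hX)).add
    (integrable_pow_of_eLpNorm_lt_top hY)).const_mul (3 ^ (2 * m))).mono'
    ((aestronglyMeasurable_growthWeight m X Y).pow 2) (ae_of_all _ fun ξ => ?_)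
  rw [Real.norm_of_nonneg (by positivity)]
  exact growthWeight_sq_le m X Y ξ

theorem norm_toLp_growthWeight_sq_le {m : ℕ} {X Y : H}
    (hX : eLpNorm X ((2 * m : ℕ) : ℝ≥0∞) μ01 < ∞) (hY : eLpNorm Y ((2 * m : ℕ) : ℝ≥0∞) μ01 < ∞) :
    ‖(memLp_growthWeight hX hY).toLp _‖ ^ 2 ≤
      3 ^ (2 * m) * (1 + (∫ ξ, |X ξ| ^ (2 * m) ∂μ01) + ∫ ξ, |Y ξ| ^ (2 * m) ∂μ01) := by
  have hiX := integrable_pow_of_eLpNorm_lt_top hX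
  have hiY := integrable_pow_of_eLpNorm_lt_top hY
  have h1 : ∫ _, (1 : ℝ) ∂μ01 = 1 := by simp [μ01]
  have hi1 : Integrable (fun ξ => 1 + |X ξ| ^ (2 * m)) μ01 := (integrable_const 1).add hiX
  have e : 3 ^ (2 * m) * (1 + (∫ ξ, |X ξ| ^ (2 * m) ∂μ01) + ∫ ξ, |Y ξ| ^ (2 * m) ∂μ01) =
      ∫ ξ, 3 ^ (2 * m) * (1 + |X ξ| ^ (2 * m) + |Y ξ| ^ (2 * m)) ∂μ01 := by
    rw [integral_const_mul, integral_add hi1 hiY,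
      integral_add (integrable_const 1) hiX, h1]
  rw [← real_inner_self_eq_norm_sq, inner_eq_integral, e]
  refine integral_mono_ae ((Lp.memLp _).integrable_mul (Lp.memLp _))
    ((((integrable_const 1).add hiX).add hiY).const_mul _) ?_
  filter_upwards [(memLp_growthWeight hX hY).coeFn_toLp] with ξ hξ
  rw [hξ, ← sq]
  exact growthWeight_sq_le m X Y ξ

/-- The class in `L²(0,1)` of a square integrable function, and `0` otherwise. -/
def classOf (q : ℝ → ℝ) : H := open scoped Classical in if h : MemLp q 2 μ01 then h.toLp q else 0

theorem coeFn_classOf {q : ℝ → ℝ} (h : MemLp q 2 μ01) : classOf q =ᵐ[μ01] q := by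
  rw [classOf, dif_pos h]; exact h.coeFn_toLp

theorem norm_classOf_le {q : ℝ → ℝ} {A : H} {c : ℝ} (hq : AEStronglyMeasurable q μ01)
    (h : ∀ᵐ ξ ∂μ01, |q ξ| ≤ c * A ξ) (hA : ∀ᵐ ξ ∂μ01, 0 ≤ A ξ) :
    MemLp q 2 μ01 ∧ ‖classOf q‖ ≤ c * ‖A‖ := by
  have hq2 : MemLp q 2 μ01 := by
    refine MemLp.of_le_mul (c := c) (Lp.memLp A) hq ?_
    filter_upwards [h, hA] with ξ h1 h2
    rwa [Real.norm_eq_abs, Real.norm_of_nonneg h2]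
  refine ⟨hq2, Lp.norm_le_mul_norm_of_ae_le_mul ?_⟩
  filter_upwards [h, hA, coeFn_classOf hq2] with ξ h1 h2 h3
  rwa [h3, Real.norm_eq_abs, Real.norm_of_nonneg h2]

/-- The Nemytskii operator `ξ ↦ q(ξ, t, X(ξ))`. -/
def nemytskii (q : ℝ → ℝ → ℝ → ℝ) (t : ℝ) (X : H) (ξ : ℝ) : ℝ := q ξ t (X ξ)

theorem IsCoefficient.measurable_nemytskii {T : ℝ} {q : ℝ → ℝ → ℝ → ℝ} (hq : IsCoefficient T q)
    (t : ℝ) (X : H) : Measurable (nemytskii q t X) :=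
  hq.1.comp (measurable_id.prodMk (measurable_const.prodMk (Lp.stronglyMeasurable X).measurable))

/-- The eigenfunction `√2 sin((k+1)πξ)` as a function on `ℝ`, with class `eigfun k` in `H`; it
serves as a test function. -/
def sinFun (k : ℕ) (ξ : ℝ) : ℝ := √2 * Real.sin (((k : ℝ) + 1) * Real.pi * ξ)

theorem contDiff_sinFun (k : ℕ) : ContDiff ℝ 2 (sinFun k) := by
  unfold sinFun; fun_prop

theorem deriv_sinFun (k : ℕ) : deriv (sinFun k) =
    fun ξ => ((k : ℝ) + 1) * Real.pi * (√2 * Real.cos (((k : ℝ) + 1) * Real.pi * ξ)) := by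
  ext ξ
  have h1 := ((hasDerivAt_id ξ).const_mul (((k : ℝ) + 1) * Real.pi)).sin.const_mul √2
  rw [show sinFun k = fun ξ => √2 * Real.sin (((k : ℝ) + 1) * Real.pi * id ξ) from rfl, h1.deriv]
  simp only [id_eq, mul_one]; ring

theorem deriv_deriv_sinFun (k : ℕ) : deriv (deriv (sinFun k)) =
    fun ξ => -(eigval k * sinFun k ξ) := by
  rw [deriv_sinFun]
  ext ξ
  have h1 := (((hasDerivAt_id ξ).const_mul (((k : ℝ) + 1) * Real.pi)).cos.const_mul √2).const_mul
    (((k : ℝ) + 1) * Real.pi)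
  simp only [id_eq] at h1
  rw [h1.deriv, eigval, sinFun]
  ring

theorem sinFun_zero (k : ℕ) : sinFun k 0 = 0 := by simp [sinFun]

theorem sinFun_one (k : ℕ) : sinFun k 1 = 0 := by
  have := Real.sin_int_mul_pi ((k : ℤ) + 1)
  push_cast at this
  simp [sinFun, this]

theorem inner_classOf_sub_toH {p q φ : ℝ → ℝ} (hφ : Continuous φ) (hp : Integrable p μ01)
    (hq : Integrable q μ01) (h : MemLp (p - q) 2 μ01) :
    inner ℝ (classOf (p - q)) (toH φ hφ) =
      (∫ ξ, p ξ * φ ξ ∂μ01) - ∫ ξ, q ξ * φ ξ ∂μ01 := by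
  obtain ⟨C, hC⟩ := isCompact_Icc.exists_bound_of_continuousOn
    (s := Icc (0 : ℝ) 1) hφ.continuousOn
  have hb : ∀ᵐ ξ ∂μ01, ‖φ ξ‖ ≤ C := by
    filter_upwards [ae_restrict_mem measurableSet_Ioo] with x hx
    exact hC x (Ioo_subset_Icc_self hx)
  rw [real_inner_comm, inner_toH, ← integral_sub (hp.mul_bdd hφ.aestronglyMeasurable hb)
    (hq.mul_bdd hφ.aestronglyMeasurable hb)]
  refine integral_congr_ae ?_
  filter_upwards [coeFn_classOf h] with ξ hξ
  rw [hξ, Pi.sub_apply, sub_mul]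

/-- The bounds at a fixed time on the increments of the coefficients between two states, in terms
of the weight `A = (1 + |X| + |Y|)^m`. Quadratic quantities such as `|g(X) - g(Y)|²` are absorbed
by the weight because `m ≥ 2`. -/
theorem nemytskii_sub_bounds {T : ℝ} {m : ℕ} (hm : 2 ≤ m) {f g : ℝ → ℝ → ℝ → ℝ}
    (hf : IsCoefficient T f) (hg : IsCoefficient T g) {t c Lf Lg : ℝ} (hc : 0 ≤ c)
    (hf_growth : ∀ z : ℝ, ∀ ξ ∈ Ioo (0 : ℝ) 1, |f ξ t z| ≤ c * (1 + |z| ^ m))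
    (hf_lip : ∀ ξ ∈ Ioo (0 : ℝ) 1, ∀ z₁ z₂ : ℝ, (f ξ t z₁ - f ξ t z₂) * (z₁ - z₂) ≤
      Lf * (1 + |z₁| ^ (m - 1) + |z₂| ^ (m - 1)) * |z₁ - z₂| ^ 2)
    (hg_lip : ∀ ξ ∈ Ioo (0 : ℝ) 1, ∀ z₁ z₂ : ℝ,
      |g ξ t z₁ - g ξ t z₂| ≤ Lg * (1 + |z₁| + |z₂|) * |z₁ - z₂|)
    {X Y : H} (hX : eLpNorm X ((2 * m : ℕ) : ℝ≥0∞) μ01 < ∞)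
    (hY : eLpNorm Y ((2 * m : ℕ) : ℝ≥0∞) μ01 < ∞) :
    ∃ A F Γ : H, (∀ᵐ ξ ∂μ01, 0 ≤ A ξ) ∧
      ‖A‖ ^ 2 ≤ 3 ^ (2 * m) * (1 + (∫ ξ, |X ξ| ^ (2 * m) ∂μ01) + ∫ ξ, |Y ξ| ^ (2 * m) ∂μ01) ∧
      F = classOf (nemytskii f t X - nemytskii f t Y) ∧
      Γ = classOf (nemytskii g t X - nemytskii g t Y) ∧
      MemLp (nemytskii f t X - nemytskii f t Y) 2 μ01 ∧
      MemLp (nemytskii g t X - nemytskii g t Y) 2 μ01 ∧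
      ‖F‖ ≤ 2 * c * ‖A‖ ∧ ‖Γ‖ ≤ |Lg| * ‖A‖ ∧
      (∀ᵐ ξ ∂μ01, F ξ * (X - Y) ξ ≤ (3 * |Lf| + Lg ^ 2) * (A ξ * (X - Y) ξ ^ 2)) ∧
      (∀ᵐ ξ ∂μ01, Γ ξ ^ 2 ≤ (3 * |Lf| + Lg ^ 2) * (A ξ * (X - Y) ξ ^ 2)) := by
  have hAe := (memLp_growthWeight hX hY).coeFn_toLp
  set A : H := (memLp_growthWeight hX hY).toLp _ with hAdef
  have hA0 : ∀ᵐ ξ ∂μ01, 0 ≤ A ξ := by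
    filter_upwards [hAe] with ξ h
    rw [h]; exact pow_nonneg (zero_le_one.trans (one_le_base _ _)) _
  have hpow : ∀ ξ, ∀ k ≤ m, (1 + |X ξ| + |Y ξ|) ^ k ≤ growthWeight m X Y ξ := fun ξ k hk =>
    pow_le_pow_right₀ (one_le_base _ _) hk
  have hpowX : ∀ ξ, ∀ k ≤ m, |X ξ| ^ k ≤ growthWeight m X Y ξ := fun ξ k hk =>
    (pow_le_pow_left₀ (abs_nonneg _) (by linarith [abs_nonneg (Y ξ)]) k).trans (hpow ξ k hk)
  have hpowY : ∀ ξ, ∀ k ≤ m, |Y ξ| ^ k ≤ growthWeight m X Y ξ := fun ξ k hk =>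
    (pow_le_pow_left₀ (abs_nonneg _) (by linarith [abs_nonneg (X ξ)]) k).trans (hpow ξ k hk)
  have hw1 : ∀ ξ, 1 ≤ growthWeight m X Y ξ := fun ξ => one_le_pow₀ (one_le_base _ _)
  have hF := norm_classOf_le (A := A) (c := 2 * c)
    ((hf.measurable_nemytskii t X).sub (hf.measurable_nemytskii t Y)).aestronglyMeasurable (by
      filter_upwards [hAe, ae_restrict_mem measurableSet_Ioo] with ξ hξ hmem
      have h1 := hf_growth (X ξ) ξ hmem
      have h2 := hf_growth (Y ξ) ξ hmem
      have h3 : 1 + |X ξ| ^ m + (1 + |Y ξ| ^ m) ≤ 2 * growthWeight m X Y ξ := by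
        have : 1 + |X ξ| ^ m + |Y ξ| ^ m ≤ growthWeight m X Y ξ := by
          have e1 := pow_add_pow_le (zero_le_one' ℝ) (abs_nonneg (X ξ)) (n := m) (by omega)
          have e2 := pow_add_pow_le (by positivity : 0 ≤ 1 + |X ξ|) (abs_nonneg (Y ξ)) (n := m)
            (by omega)
          rw [one_pow] at e1
          exact (add_le_add_left e1 _).trans e2
        linarith [hw1 ξ]
      rw [hξ, Pi.sub_apply]
      calc |nemytskii f t X ξ - nemytskii f t Y ξ| ≤ |f ξ t (X ξ)| + |f ξ t (Y ξ)| := abs_sub _ _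
        _ ≤ c * (1 + |X ξ| ^ m + (1 + |Y ξ| ^ m)) := by linarith
        _ ≤ c * (2 * growthWeight m X Y ξ) := mul_le_mul_of_nonneg_left h3 hc
        _ = _ := by ring) hA0
  have hΓ := norm_classOf_le (A := A) (c := |Lg|)
    ((hg.measurable_nemytskii t X).sub (hg.measurable_nemytskii t Y)).aestronglyMeasurable (by
      filter_upwards [hAe, ae_restrict_mem measurableSet_Ioo] with ξ hξ hmem
      rw [hξ, Pi.sub_apply]
      have h1 : |X ξ - Y ξ| ≤ 1 + |X ξ| + |Y ξ| := (abs_sub _ _).trans (by linarith)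
      have h2 := hpow ξ 2 hm
      calc |nemytskii g t X ξ - nemytskii g t Y ξ|
          ≤ Lg * (1 + |X ξ| + |Y ξ|) * |X ξ - Y ξ| := hg_lip ξ hmem _ _
        _ ≤ |Lg| * (1 + |X ξ| + |Y ξ|) * (1 + |X ξ| + |Y ξ|) := by gcongr; exact le_abs_self _
        _ = |Lg| * (1 + |X ξ| + |Y ξ|) ^ 2 := by ring
        _ ≤ _ := by gcongr) hA0
  refine ⟨A, _, _, hA0, norm_toLp_growthWeight_sq_le hX hY, rfl, rfl, hF.1, hΓ.1, hF.2, hΓ.2,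
    ?_, ?_⟩
  · filter_upwards [hAe, coeFn_classOf hF.1, Lp.coeFn_sub X Y,
      ae_restrict_mem measurableSet_Ioo] with ξ h1 h2 h3 hmem
    have hl := hf_lip ξ hmem (X ξ) (Y ξ)
    rw [h1, h2, h3]
    simp only [Pi.sub_apply]
    rw [sq_abs] at hl
    refine hl.trans ?_
    have hsum : 1 + |X ξ| ^ (m - 1) + |Y ξ| ^ (m - 1) ≤ 3 * growthWeight m X Y ξ := by
      linarith [hw1 ξ, hpowX ξ (m - 1) (Nat.sub_le _ _), hpowY ξ (m - 1) (Nat.sub_le _ _)]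
    have hw0 : 0 ≤ growthWeight m X Y ξ := zero_le_one.trans (hw1 ξ)
    calc Lf * (1 + |X ξ| ^ (m - 1) + |Y ξ| ^ (m - 1)) * (X ξ - Y ξ) ^ 2
        ≤ |Lf| * (3 * growthWeight m X Y ξ) * (X ξ - Y ξ) ^ 2 := by gcongr; exact le_abs_self _
      _ = 3 * |Lf| * (growthWeight m X Y ξ * (X ξ - Y ξ) ^ 2) := by ring
      _ ≤ _ := by gcongr; linarith [sq_nonneg Lg]
  · filter_upwards [hAe, coeFn_classOf hΓ.1, Lp.coeFn_sub X Y,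
      ae_restrict_mem measurableSet_Ioo] with ξ h1 h2 h3 hmem
    have hl := hg_lip ξ hmem (X ξ) (Y ξ)
    rw [h1, h2, h3]
    simp only [Pi.sub_apply]
    rw [← sq_abs]
    have hw0 : 0 ≤ growthWeight m X Y ξ := zero_le_one.trans (hw1 ξ)
    calc |nemytskii g t X ξ - nemytskii g t Y ξ| ^ 2
        ≤ (Lg * (1 + |X ξ| + |Y ξ|) * |X ξ - Y ξ|) ^ 2 :=
          pow_le_pow_left₀ (abs_nonneg _) hl 2
      _ = Lg ^ 2 * ((1 + |X ξ| + |Y ξ|) ^ 2 * (X ξ - Y ξ) ^ 2) := by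
          rw [mul_pow, mul_pow, sq_abs]; ring
      _ ≤ (3 * |Lf| + Lg ^ 2) * (growthWeight m X Y ξ * (X ξ - Y ξ) ^ 2) := by
          gcongr
          · linarith [abs_nonneg Lf]
          · exact hpow ξ 2 hm

theorem integrableOn_integral_pow {T : ℝ} {m : ℕ} (hm : m ≠ 0) {X : ℝ → H}
    (hXm : AEStronglyMeasurable X (volume.restrict (Icc 0 T)))
    (hX : ∫⁻ t in Icc 0 T, (eLpNorm (X t) ((2 * m : ℕ) : ℝ≥0∞) μ01) ^ (2 * m) < ∞) :
    IntegrableOn (fun t => ∫ ξ, |X t ξ| ^ (2 * m) ∂μ01) (Icc 0 T) ∧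
      ∀ᵐ t ∂volume.restrict (Icc 0 T), eLpNorm (X t) ((2 * m : ℕ) : ℝ≥0∞) μ01 < ∞ := by
  have hmeas := (aemeasurable_eLpNorm_comp hXm ((2 * m : ℕ) : ℝ≥0∞)).pow_const (2 * m)
  constructor
  · simp_rw [integral_norm_pow_eq_toReal _ (by omega : 2 * m ≠ 0)]
    exact integrable_toReal_of_lintegral_ne_top hmeas hX.ne
  · filter_upwards [ae_lt_top' hmeas hX.ne] with t ht
    exact (ENNReal.pow_lt_top_iff.1 ht).resolve_right (by omega)

/-! ### Uniqueness for almost every path -/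

/-- The conditions satisfied by almost every path `X` of a solution, tested against the
eigenfunctions; `N k t` is the contribution of the initial value and of the noise to the `k`-th
coefficient at time `t`. -/
structure IsPathSolution (T : ℝ) (m : ℕ) (f g : ℝ → ℝ → ℝ → ℝ) (N : ℕ → ℝ → ℝ) (X : ℝ → H) :
    Prop where
  bounded : MemLp X ∞ (volume.restrict (Icc 0 T))
  lintegral_lt_top :
    ∫⁻ t in Icc 0 T, (eLpNorm (X t) ((2 * m : ℕ) : ℝ≥0∞) μ01) ^ (2 * m) < ∞
  integrable_space : ∀ᵐ r ∂volume.restrict (Icc 0 T),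
    Integrable (nemytskii f r (X r)) μ01 ∧ Integrable (nemytskii g r (X r)) μ01
  integrable_time : ∀ k,
    IntegrableOn (fun r => ∫ ξ, nemytskii f r (X r) ξ * sinFun k ξ ∂μ01) (Icc 0 T) ∧
    IntegrableOn (fun r => ∫ ξ, nemytskii g r (X r) ξ * deriv (sinFun k) ξ ∂μ01) (Icc 0 T)
  equation : ∀ k, ∀ t ∈ Icc 0 T, ∫ ξ, X t ξ * sinFun k ξ ∂μ01 =
    N k t + (∫ r in (0 : ℝ)..t, ∫ ξ, X r ξ * deriv (deriv (sinFun k)) ξ ∂μ01)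
      + (∫ r in (0 : ℝ)..t, ∫ ξ, nemytskii f r (X r) ξ * sinFun k ξ ∂μ01)
      - (∫ r in (0 : ℝ)..t, ∫ ξ, nemytskii g r (X r) ξ * deriv (sinFun k) ξ ∂μ01)

theorem inner_eigfun (k : ℕ) (X : H) : inner ℝ (eigfun k) X = ∫ ξ, X ξ * sinFun k ξ ∂μ01 :=
  inner_toH _ _ X

theorem integral_mul_deriv_deriv_sinFun (k : ℕ) (X : H) :
    ∫ ξ, X ξ * deriv (deriv (sinFun k)) ξ ∂μ01 = -(eigval k * inner ℝ (eigfun k) X) := by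
  rw [inner_eigfun, deriv_deriv_sinFun]
  simp_rw [mul_neg, integral_neg, mul_left_comm _ (eigval k), integral_const_mul]

theorem deriv_sinFun_eq_cos (k : ℕ) (ξ : ℝ) : deriv (sinFun k) ξ = ((k : ℝ) + 1) * Real.pi *
    ((if k + 1 = 0 then 1 else √2) * Real.cos ((k + 1 : ℕ) * Real.pi * ξ)) := by
  rw [deriv_sinFun]; simp

theorem IsPathSolution.eq {T : ℝ} {m : ℕ} (hm : 2 ≤ m) {f g : ℝ → ℝ → ℝ → ℝ}
    (hf : IsCoefficient T f) (hg : IsCoefficient T g) (hf_growth : PolynomialGrowth T m f)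
    (hg_lip : BurgersLipschitz T g) (hf_lip : OneSidedLocalLipschitz T m f) {N : ℕ → ℝ → ℝ}
    {X Y : ℝ → H} (hX : IsPathSolution T m f g N X) (hY : IsPathSolution T m f g N Y)
    (hXY : MemL2H01 T fun t => X t - Y t) : ∀ t ∈ Icc 0 T, X t = Y t := by
  obtain ⟨c, hc, hc0, hcf⟩ := hf_growth
  obtain ⟨Lg, hLg⟩ := hg_lip
  obtain ⟨Lf, hLf⟩ := hf_lip
  obtain ⟨-, v, hv, huv⟩ := hXY
  set ν := volume.restrict (Icc (0 : ℝ) T) with hν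
  obtain ⟨hXi, hXt⟩ := integrableOn_integral_pow (by omega) hX.bounded.1 hX.lintegral_lt_top
  obtain ⟨hYi, hYt⟩ := integrableOn_integral_pow (by omega) hY.bounded.1 hY.lintegral_lt_top
  set F : ℝ → H := fun r => classOf (nemytskii f r (X r) - nemytskii f r (Y r)) with hF
  set Γ : ℝ → H := fun r => classOf (nemytskii g r (X r) - nemytskii g r (Y r)) with hΓ
  set a : ℝ → ℝ := fun r => 3 ^ (2 * m) *
    (1 + (∫ ξ, |X r ξ| ^ (2 * m) ∂μ01) + ∫ ξ, |Y r ξ| ^ (2 * m) ∂μ01) with ha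
  have hai : IntegrableOn a (Icc 0 T) :=
    (((integrable_const 1).add hXi).add hYi).const_mul _
  have ha0 : ∀ r, 0 ≤ a r := fun r => by
    have h1 : 0 ≤ ∫ ξ, |X r ξ| ^ (2 * m) ∂μ01 := integral_nonneg fun ξ => by positivity
    have h2 : 0 ≤ ∫ ξ, |Y r ξ| ^ (2 * m) ∂μ01 := integral_nonneg fun ξ => by positivity
    positivity
  set C := 3 * |Lf| + Lg ^ 2 with hC
  have hbounds : ∀ᵐ r ∂ν,
      MemLp (nemytskii f r (X r) - nemytskii f r (Y r)) 2 μ01 ∧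
      MemLp (nemytskii g r (X r) - nemytskii g r (Y r)) 2 μ01 ∧
      ‖F r‖ ≤ c r ^ 2 + (1 + Lg ^ 2) * a r ∧ ‖Γ r‖ ^ 2 ≤ c r ^ 2 + (1 + Lg ^ 2) * a r ∧
      -‖v r‖ ^ 2 + inner ℝ (F r) (X r - Y r) - inner ℝ (Γ r) (v r) ≤
        (2 * C ^ 2 + 1) * (1 + a r) * ‖X r - Y r‖ ^ 2 := by
    filter_upwards [hXt, hYt, huv, ae_restrict_mem measurableSet_Icc] with r h1 h2 h3 hr
    obtain ⟨A, F', Γ', hA0, hA, hF', hΓ', hFm, hΓm, hFA, hΓA, hFu, hΓu⟩ :=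
      nemytskii_sub_bounds hm hf hg (hc0 r hr) (hcf r hr) (hLf r hr) (hLg r hr) h1 h2
    obtain rfl : F' = F r := hF'
    obtain rfl : Γ' = Γ r := hΓ'
    have hAa : ‖A‖ ^ 2 ≤ a r := hA
    have hLa := mul_le_mul_of_nonneg_left hAa (sq_nonneg Lg)
    have hLa0 := mul_nonneg (sq_nonneg Lg) (ha0 r)
    refine ⟨hFm, hΓm, ?_, ?_, ?_⟩
    · nlinarith [sq_nonneg (c r - ‖A‖)]
    · have := pow_le_pow_left₀ (norm_nonneg _) hΓA 2
      rw [mul_pow, sq_abs] at this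
      nlinarith [sq_nonneg (c r), ha0 r]
    · refine (h3.energy_le (C := C) (by positivity) hA0 hFu hΓu).trans ?_
      gcongr
  have hspace : ∀ᵐ r ∂ν, ∀ φ (hφ : Continuous φ),
      inner ℝ (F r) (toH φ hφ) = (∫ ξ, nemytskii f r (X r) ξ * φ ξ ∂μ01) -
        (∫ ξ, nemytskii f r (Y r) ξ * φ ξ ∂μ01) ∧
      inner ℝ (Γ r) (toH φ hφ) = (∫ ξ, nemytskii g r (X r) ξ * φ ξ ∂μ01) -
        ∫ ξ, nemytskii g r (Y r) ξ * φ ξ ∂μ01 := by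
    filter_upwards [hbounds, hX.integrable_space, hY.integrable_space] with r h1 h2 h3 φ hφ
    exact ⟨inner_classOf_sub_toH hφ h2.1 h3.1 h1.1, inner_classOf_sub_toH hφ h2.2 h3.2 h1.2.1⟩
  have hFk : ∀ k, ∀ᵐ r ∂ν, inner ℝ (F r) (eigfun k) =
      (∫ ξ, nemytskii f r (X r) ξ * sinFun k ξ ∂μ01) -
        ∫ ξ, nemytskii f r (Y r) ξ * sinFun k ξ ∂μ01 := by
    intro k
    filter_upwards [hspace] with r hr using (hr _ _).1
  have hΓk : ∀ k : ℕ, ∀ᵐ r ∂ν, ((k : ℝ) + 1) * Real.pi * inner ℝ (Γ r) (cosMode (k + 1)) =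
      (∫ ξ, nemytskii g r (X r) ξ * deriv (sinFun k) ξ ∂μ01) -
        ∫ ξ, nemytskii g r (Y r) ξ * deriv (sinFun k) ξ ∂μ01 := by
    intro k
    filter_upwards [hspace] with r hr
    simp_rw [deriv_sinFun_eq_cos, mul_left_comm _ (((k : ℝ) + 1) * Real.pi), integral_const_mul]
    rw [← mul_sub]
    congr 1
    exact (hr _ _).2
  have hkπ : ∀ k : ℕ, ((k : ℝ) + 1) * Real.pi ≠ 0 := fun k => by positivity
  have hDi : IntegrableOn (fun r => c r ^ 2 + (1 + Lg ^ 2) * a r) (Icc 0 T) :=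
    hc.integrable_sq.add (hai.const_mul _)
  have key := eq_zero_of_energy_le (u := fun r => X r - Y r) (v := v) (F := F) (Γ := Γ)
    (β := fun r => (2 * C ^ 2 + 1) * (1 + a r)) (D := fun r => c r ^ 2 + (1 + Lg ^ 2) * a r)
    (hX.bounded.sub hY.bounded) hv huv
    (fun k => ((hX.integrable_time k).1.sub (hY.integrable_time k).1).congr
      ((hFk k).mono fun r hr => hr.symm))
    (fun k => by
      refine ((((hX.integrable_time k).2.sub (hY.integrable_time k).2).congr
        ((hΓk k).mono fun r hr => hr.symm)).const_mul (((k : ℝ) + 1) * Real.pi)⁻¹).congr ?_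
      exact ae_of_all _ fun r => inv_mul_cancel_left₀ (hkπ k) _)
    hDi
    (hbounds.mono fun r h => h.2.2.1) (hbounds.mono fun r h => h.2.2.2.1)
    (((integrable_const 1).add hai).const_mul _)
    (ae_of_all _ fun r => by have := ha0 r; positivity)
    (hbounds.mono fun r h => h.2.2.2.2) ?_
  · intro t ht
    exact sub_eq_zero.1 (key t ht)
  · intro k t ht
    have hiX : IntegrableOn (fun r => ∫ ξ, X r ξ * deriv (deriv (sinFun k)) ξ ∂μ01) (Icc 0 T) := by
      simp_rw [integral_mul_deriv_deriv_sinFun]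
      exact (((hX.bounded.integrable le_top).const_inner _).const_mul _).neg
    have hiY : IntegrableOn (fun r => ∫ ξ, Y r ξ * deriv (deriv (sinFun k)) ξ ∂μ01) (Icc 0 T) := by
      simp_rw [integral_mul_deriv_deriv_sinFun]
      exact (((hY.bounded.integrable le_top).const_inner _).const_mul _).neg
    have ii : ∀ {h : ℝ → ℝ}, IntegrableOn h (Icc 0 T) → IntervalIntegrable h volume 0 t :=
      fun hh => intervalIntegrable_of_integrableOn_Icc hh ht
    have hfX := ii (hX.integrable_time k).1
    have hfY := ii (hY.integrable_time k).1
    have hgX := ii (hX.integrable_time k).2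
    have hgY := ii (hY.integrable_time k).2
    have hr : ∫ r in (0 : ℝ)..t, (-(eigval k * inner ℝ (eigfun k) (X r - Y r)) +
        inner ℝ (F r) (eigfun k) - ((k : ℝ) + 1) * Real.pi * inner ℝ (Γ r) (cosMode (k + 1))) =
        ∫ r in (0 : ℝ)..t, (((∫ ξ, X r ξ * deriv (deriv (sinFun k)) ξ ∂μ01) -
          ∫ ξ, Y r ξ * deriv (deriv (sinFun k)) ξ ∂μ01) +
          ((∫ ξ, nemytskii f r (X r) ξ * sinFun k ξ ∂μ01) -
            ∫ ξ, nemytskii f r (Y r) ξ * sinFun k ξ ∂μ01) -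
          ((∫ ξ, nemytskii g r (X r) ξ * deriv (sinFun k) ξ ∂μ01) -
            ∫ ξ, nemytskii g r (Y r) ξ * deriv (sinFun k) ξ ∂μ01)) := by
      simp_rw [intervalIntegral.integral_of_le ht.1, ← integral_Icc_eq_integral_Ioc]
      refine integral_congr_ae ?_
      filter_upwards [ae_Icc_of_le (hFk k) ht.2, ae_Icc_of_le (hΓk k) ht.2] with r h1 h2
      rw [h1, h2, integral_mul_deriv_deriv_sinFun, integral_mul_deriv_deriv_sinFun, inner_sub_right]
      ring
    rw [hr, intervalIntegral.integral_sub (((ii hiX).sub (ii hiY)).add (hfX.sub hfY))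
        (hgX.sub hgY), intervalIntegral.integral_add ((ii hiX).sub (ii hiY)) (hfX.sub hfY),
      intervalIntegral.integral_sub (ii hiX) (ii hiY), intervalIntegral.integral_sub hfX hfY,
      intervalIntegral.integral_sub hgX hgY, inner_sub_right, inner_eigfun, inner_eigfun,
      hX.equation k t ht, hY.equation k t ht]
    ring

/-! ### Passage from the stochastic equation to its paths -/

variable {Ω : Type*} {mΩ : MeasurableSpace Ω}

/-- Wiener integrals of the same integrand agree almost surely, being limits of the same Riemann
sums. -/
theorem IsWienerIntegral.ae_eq {T : ℝ} {P : Measure Ω} {ℱ : Filtration (Icc (0 : ℝ) T) mΩ}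
    {W : ℝ → H → Ω → ℝ} (hW : IsCylindricalWiener T P ℱ W) {t : ℝ} (ht : t ∈ Icc 0 T) {Φ : ℝ → H}
    {I J : Ω → ℝ} (hI : IsWienerIntegral P W t Φ I) (hJ : IsWienerIntegral P W t Φ J) :
    I =ᵐ[P] J := by
  have hWm : ∀ s ∈ Icc 0 T, ∀ h, Measurable (W s h) := fun s hs h =>
    (hW.adapted ⟨s, hs⟩ h).mono (ℱ.le _) le_rfl
  set S : ℕ → Ω → ℝ := fun n ω => ∑ i ∈ Finset.range n,
        (W (((i : ℝ) + 1) * t / n) (Φ ((i : ℝ) * t / n)) ω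
          - W ((i : ℝ) * t / n) (Φ ((i : ℝ) * t / n)) ω) with hS
  have hSm : ∀ n, Measurable (S n) := by
    intro n
    refine Finset.measurable_fun_sum _ fun i hi => ?_
    have hin : (i : ℝ) + 1 ≤ n := by exact_mod_cast Finset.mem_range.1 hi
    have hn : (0 : ℝ) < n := by have : (0 : ℝ) ≤ i := i.cast_nonneg; linarith
    have hmem : ∀ x : ℝ, 0 ≤ x → x ≤ n → x * t / n ∈ Icc 0 T := fun x h0 hx =>
      ⟨by have := ht.1; positivity, by
        rw [div_le_iff₀ hn]
        calc x * t ≤ n * t := mul_le_mul_of_nonneg_right hx ht.1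
          _ ≤ n * T := mul_le_mul_of_nonneg_left ht.2 hn.le
          _ = T * n := mul_comm _ _⟩
    exact (hWm _ (hmem _ (by positivity) hin) _).sub (hWm _ (hmem _ (by positivity) (by linarith)) _)
  have hle : ∀ n, eLpNorm (I - J) 2 P ≤
      eLpNorm (fun ω => S n ω - I ω) 2 P + eLpNorm (fun ω => S n ω - J ω) 2 P := by
    intro n
    have e : I - J = (fun ω => S n ω - J ω) - (fun ω => S n ω - I ω) := by
      ext ω; simp
    rw [e, add_comm]
    exact eLpNorm_sub_le ((hSm n).aestronglyMeasurable.sub hJ.1)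
      ((hSm n).aestronglyMeasurable.sub hI.1) (by norm_num)
  have h0 : eLpNorm (I - J) 2 P ≤ 0 := by
    have := hI.2.add hJ.2
    rw [add_zero] at this
    exact ge_of_tendsto' this hle
  have := (eLpNorm_eq_zero_iff (hI.1.sub hJ.1) two_ne_zero).1 (le_antisymm h0 zero_le)
  filter_upwards [this] with ω hω
  exact sub_eq_zero.1 hω

/-- The stochastic convolution is unique up to indistinguishability. -/
theorem IsStochasticConvolution.ae_eq {T : ℝ} {P : Measure Ω} {ℱ : Filtration (Icc (0 : ℝ) T) mΩ}
    {W : ℝ → H → Ω → ℝ} (hW : IsCylindricalWiener T P ℱ W) {G : H →L[ℝ] H} {V V' : ℝ → Ω → H}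
    (hV : IsStochasticConvolution T P W G V) (hV' : IsStochasticConvolution T P W G V') :
    ∀ᵐ ω ∂P, ∀ t ∈ Icc 0 T, V t ω = V' t ω := by
  have hpt : ∀ t ∈ Icc 0 T, ∀ᵐ ω ∂P, V t ω = V' t ω := by
    intro t ht
    have := ae_all_iff.2 fun k =>
      (hV.integral t ht (eigfun k)).ae_eq hW ht (hV'.integral t ht (eigfun k))
    filter_upwards [this] with ω hω
    refine sub_eq_zero.1 (eq_zero_of_inner_eigfun fun k => ?_)
    rw [inner_sub_right, real_inner_comm, hω k, real_inner_comm, sub_self]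
  obtain ⟨s, hsc, hsd⟩ := TopologicalSpace.exists_countable_dense (Icc (0 : ℝ) T)
  have hs : ∀ᵐ ω ∂P, ∀ t ∈ s, V t ω = V' t ω :=
    (ae_ball_iff hsc).2 fun t _ => hpt t t.2
  filter_upwards [hs, hV.continuous_paths, hV'.continuous_paths] with ω h1 h2 h3 t ht
  have := Continuous.ext_on hsd (continuousOn_iff_continuous_domRestrict.1 h2)
    (continuousOn_iff_continuous_domRestrict.1 h3) fun t ht => h1 t ht
  exact congrFun this ⟨t, ht⟩

theorem IsSolution.ae_isPathSolution {T : ℝ} {m : ℕ} {f g : ℝ → ℝ → ℝ → ℝ} {G : H →L[ℝ] H} {x : H}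
    {P : Measure Ω} {ℱ : Filtration (Icc (0 : ℝ) T) mΩ} {W : ℝ → H → Ω → ℝ} {X : ℝ → Ω → H}
    (hX : IsSolution T f g G x P ℱ W X) (hX_norm : FiniteL2mNorm T m P X) :
    ∀ᵐ ω ∂P, IsPathSolution T m f g (fun k t => (∫ ξ, x ξ * sinFun k ξ ∂μ01) +
      W t (opSqrt G (toH (sinFun k) (contDiff_sinFun k).continuous)) ω) fun t => X t ω := by
  have h1 := ae_all_iff.2 fun k =>
    hX.integrable_time (sinFun k) (contDiff_sinFun k) (sinFun_zero k) (sinFun_one k)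
  have h2 := ae_all_iff.2 fun k =>
    hX.equation (sinFun k) (contDiff_sinFun k) (sinFun_zero k) (sinFun_one k)
  filter_upwards [hX.bounded, hX.integrable_space, hX_norm, h1, h2] with ω hb hs hn ht he
  refine ⟨hb, hn, hs, ht, fun k t htT => ?_⟩
  rw [he k t htT]
  simp only [nemytskii]
  ring

end SPDE

end

open SPDE
theorem theorem4p6 (T : ℝ) (hT : 0 < T) (m : ℕ) (hm : 2 ≤ m)
    (f g : ℝ → ℝ → ℝ → ℝ)
    (hf : IsCoefficient T f) (hg : IsCoefficient T g)
    (hf_growth : PolynomialGrowth T m f) (hf_diss : Dissipativity T f)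
    (hg_growth : BurgersGrowth T g) (hg_lip : BurgersLipschitz T g)
    (G : H →L[ℝ] H) (hG_pos : G.IsPositive) (hG_inv : IsUnit G) (hG_reg : NoiseRegularity G)
    (hf_lip : OneSidedLocalLipschitz T m f)
    (x : H)
    {Ω : Type*} {mΩ : MeasurableSpace Ω} (P : Measure Ω) [IsProbabilityMeasure P]
    (ℱ : Filtration (Set.Icc (0 : ℝ) T) mΩ)
    (W : ℝ → H → Ω → ℝ) (hW : IsCylindricalWiener T P ℱ W)
    (X₁ X₂ : ℝ → Ω → H)
    (hX₁ : IsSolution T f g G x P ℱ W X₁) (hX₂ : IsSolution T f g G x P ℱ W X₂)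
    (hX₁_norm : FiniteL2mNorm T m P X₁) (hX₂_norm : FiniteL2mNorm T m P X₂)
    (hX₁_reg : RegularModuloConvolution T P W G X₁)
    (hX₂_reg : RegularModuloConvolution T P W G X₂) :
    ∀ᵐ ω ∂P, ∀ t ∈ Set.Icc (0 : ℝ) T, X₁ t ω = X₂ t ω := by
  obtain ⟨V₁, hV₁, hreg₁⟩ := hX₁_reg
  obtain ⟨V₂, hV₂, hreg₂⟩ := hX₂_reg
  filter_upwards [hX₁.ae_isPathSolution hX₁_norm, hX₂.ae_isPathSolution hX₂_norm,
    hV₁.ae_eq hW hV₂, hreg₁, hreg₂] with ω h₁ h₂ hV hr₁ hr₂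
  refine h₁.eq hm hf hg hf_growth hg_lip hf_lip h₂
    ⟨(h₁.bounded.sub h₂.bounded).mono_exponent le_top, ?_⟩
  obtain ⟨-, Z₁, hZ₁, hd₁⟩ := hr₁
  obtain ⟨-, Z₂, hZ₂, hd₂⟩ := hr₂
  refine ⟨Z₁ - Z₂, hZ₁.sub hZ₂, ?_⟩
  filter_upwards [hd₁, hd₂, ae_restrict_mem measurableSet_Icc] with t e₁ e₂ ht
  have := e₁.sub e₂
  rwa [hV t ht, sub_sub_sub_cancel_right] at this
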